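/- **Setting.** Let $d\ge 2$, let $k\ge 1$ be odd, and let $\Omega\subset\mathbb R^d$ be a connected set with $\operatorname{int}\overline\Omega=\Omega$ (e.g. a connected bounded Lipschitz polytope). Let $\mathcal T$ be a finite conforming simplicial mesh with $\bigcup_{K\in\mathcal T}K=\overline\Omega$ that contains more than one simplex. Let $\mathcal S$ be the simplicial complex of all faces of the simplices, $\mathcal S_\ell$ the set of $\ell$-dimensional faces, $\mathcal F=\mathcal S_{d-1}$ the set of facets, $\mathcal F(K)$ the set of facets of $K$, and $\mathcal V(\tau)$ the vertex set of $\tau$. Put $\mathcal S_{\partial\Omega}=\{\tau\in\mathcal S:\tau\subset\partial\Omega\}$, $\mathcal S_\Omega=\mathcal S\setminus\mathcal S_{\partial\Omega}$, $\mathcal F_{\partial\Omega}=\{F\in\mathcal F:F\subset\partial\Omega\}$, $\mathcal F_\Omega=\mathcal F\setminus\mathcal F_{\partial\Omega}$. A piecewise polynomial $u$ of degree at most $k$ is given by its polynomials $u|_K$, $K\in\mathcal T$, which also define its one-sided values on $\partial K$. **Spaces.** $S_k(\mathcal T)$ is the space of functions in $C^0(\overline\Omega)$ that are polynomials of degree at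 most $k$ on every $K\in\mathcal T$; $S_{k,0}(\mathcal T)$ is its subspace of functions vanishing on $\partial\Omega$. Let $P_n^{(\alpha,\beta)}$ denote the Jacobi polynomials and $\lambda_{K,\mathbf z}$ the barycentric coordinate of $K$ for $\mathbf z\in\mathcal V(K)$. For $F\in\mathcal F$ let $B_k^{\mathrm{CR},F}$ be given by $$B_k^{\mathrm{CR},F}|_K=P_k^{(0,d-2)}(1-2\lambda_{K,F})-\frac1d\Bigl(-1+\sum_{\mathbf z\in\mathcal V(K)}P_k^{(0,d-2)}(1-2\lambda_{K,\mathbf z})\Bigr)\quad\text{if }F\subset K,$$ and $B_k^{\mathrm{CR},F}|_K=0$ otherwise; here $\lambda_{K,F}$ is the barycentric coordinate of the vertex of $K$ opposite to $F$. Set $$\mathrm{CR}_k(\mathcal T)=S_k(\mathcal T)+\operatorname{span}\{B_k^{\mathrm{CR},F}:F\in\mathcal F\},\qquad \mathrm{CR}_{k,0}(\mathcal T)=S_{k,0}(\mathcal T)+\operatorname{span}\{B_k^{\mathrm{CR},F}:F\in\mathcal F_\Omega\}.$$ **Basis functions.** Fix a numbering $\mathbf A_0(\tau),\dots,\mathbf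 A_\ell(\tau)$ of the vertices of every face $\tau\in\mathcal S_\ell$. Let $\varphi_{\mathbf z}$ be the continuous piecewise affine hat function of the vertex $\mathbf z$. For $\alpha\in\mathbb N_0^\ell$ let $$P^{\mathrm{bary}}_\alpha(y_0,\dots,y_\ell)=\prod_{j=1}^{\ell}r_j^{\alpha_j}P^{(s_j,1)}_{\alpha_j}\Bigl(\frac{2y_j}{r_j}-1\Bigr),\quad r_j=y_0+\sum_{m=j}^{\ell}y_m,\quad s_j=2\sum_{m=j+1}^{\ell}\alpha_m+2(\ell-j)+1$$ (a polynomial in $y$). Let $\mathcal I_k$ be the set of all pairs $(\tau,\alpha)$ with $\tau\in\mathcal S_\ell$, $1\le\ell\le d$, $\alpha\in\mathbb N_0^\ell$ and $|\alpha|\le k-(\ell+1)$; let $\mathcal I_{k,\Omega}$ be the subset of pairs with $\tau\in\mathcal S_\Omega$, and $\mathcal I_{k,\partial\Omega}=\mathcal I_k\setminus\mathcal I_{k,\Omega}$. For $(\tau,\alpha)\in\mathcal I_k$ put $$B_{\tau,\alpha}=\Bigl(\prod_{\mathbf z\in\mathcal V(\tau)}\varphi_{\mathbf z}\Bigr)P^{\mathrm{bary}}_\alpha\bigl(\varphi_{\mathbf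 A_0(\tau)},\dots,\varphi_{\mathbf A_\ell(\tau)}\bigr),$$ $$\mathcal B_k=\{B_{\tau,\alpha}:(\tau,\alpha)\in\mathcal I_k\}\cup\{B_k^{\mathrm{CR},F}:F\in\mathcal F\},\qquad \mathcal B_{k,0}=\{B_{\tau,\alpha}:(\tau,\alpha)\in\mathcal I_{k,\Omega}\}\cup\{B_k^{\mathrm{CR},F}:F\in\mathcal F_\Omega\}.$$ **Weights and degrees of freedom.** *Simplex weights* are functions $g^K_{\tau,\alpha},g^{\mathrm{CR},K}_F\in L^2(K)$, for $K\in\mathcal T$, $(\tau,\alpha)\in\mathcal I_k$ with $\tau\subset K$, and $F\in\mathcal F(K)$, such that for each $K$ the functionals $J^K_{\tau,\alpha}u=\int_Kg^K_{\tau,\alpha}u$ and $J^{\mathrm{CR},K}_Fu=\int_Kg^{\mathrm{CR},K}_Fu$ are bidual to the family of restrictions $B_{\tau,\alpha}|_K$ ($\tau\subset K$), $B_k^{\mathrm{CR},F}|_K$ ($F\in\mathcal F(K)$), i.e. give $1$ at the function with the same index and $0$ at the others. For $F\in\mathcal F_{\partial\Omega}$ let $K_F$ be the simplex containing $F$. *Facet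 weights* are functions $g^F_{\tau,\alpha},g^{\mathrm{CR},F}_{F'}\in L^2(F)$, for $F\in\mathcal F_{\partial\Omega}$, $(\tau,\alpha)\in\mathcal I_k$ with $\tau\subset F$, and $F'\in\mathcal F(K_F)\cap\mathcal F_{\partial\Omega}$, such that for each $F$ the functionals $J^F_{\tau,\alpha}u=\int_Fg^F_{\tau,\alpha}\,u|_{K_F}$ and $J^{\mathrm{CR},F}_{F'}u=\int_Fg^{\mathrm{CR},F}_{F'}\,u|_{K_F}$ are bidual to the family of the traces on $F$ of $B_{\tau,\alpha}|_{K_F}$ ($\tau\subset F$) and $B_k^{\mathrm{CR},F'}|_{K_F}$ ($F'\in\mathcal F(K_F)\cap\mathcal F_{\partial\Omega}$). We call facet weights *compatible* if, moreover, for every $F\in\mathcal F_{\partial\Omega}$ the functionals $J^F_{\tau,\alpha}$ ($\tau\subset F$) and $J^{\mathrm{CR},F}_F$ vanish at $B_k^{\mathrm{CR},F'}$ for all $F'\in\mathcal F(K_F)\cap\mathcal F_\Omega$. Let $\operatorname{mark}:\mathcal S\to\mathcal T\cup\mathcal F_{\partial\Omega}$ be any map with $\tau\subset\operatorname{mark}(\tau)$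 for all $\tau\in\mathcal S$, $\operatorname{mark}(\tau)\in\mathcal T$ for $\tau\in\mathcal S_\Omega$, and $\operatorname{mark}(\tau)\in\mathcal F_{\partial\Omega}$ for $\tau\in\mathcal S_{\partial\Omega}$. The degrees of freedom are $$\mathcal J_{k,0}=\{J^{\operatorname{mark}(\tau)}_{\tau,\alpha}:(\tau,\alpha)\in\mathcal I_{k,\Omega}\}\cup\{J^{\mathrm{CR},\operatorname{mark}(F)}_F:F\in\mathcal F_\Omega\},$$ $$\mathcal J_k=\mathcal J_{k,0}\cup\{J^{\operatorname{mark}(\tau)}_{\tau,\alpha}:(\tau,\alpha)\in\mathcal I_{k,\partial\Omega}\}\cup\{J^{\mathrm{CR},F}_F:F\in\mathcal F_{\partial\Omega}\}.$$ **Theorem.** 1. There exist simplex weights and compatible facet weights such that $\mathcal B_k$ is a basis of $\mathrm{CR}_k(\mathcal T)$ with bidual basis $\mathcal J_k$, and $\mathcal B_{k,0}$ is a basis of $\mathrm{CR}_{k,0}(\mathcal T)$ with bidual basis $\mathcal J_{k,0}$. (Here $J_i$ is a bidual basis for a basis $b_i$ of $V$ if the $J_i$ are linear functionals on $V$ with $J_i(b_j)=\delta_{ij}$.)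 2. For every choice of simplex weights, $\mathcal J_{k,0}$ is bidual to the basis $\mathcal B_{k,0}$ of $\mathrm{CR}_{k,0}(\mathcal T)$. 3. For every choice of simplex weights and facet weights, $\mathcal J_k$ is a basis of the dual space of $\mathrm{CR}_k(\mathcal T)$; if the facet weights are compatible, $\mathcal J_k$ is bidual to the basis $\mathcal B_k$ of $\mathrm{CR}_k(\mathcal T)$. -/

import Mathlib

open MeasureTheory Set
open scoped Classical BigOperators

noncomputable section

namespace CRFem

/-- The ambient Euclidean space `ℝ^d`. -/
abbrev E (d : ℕ) : Type := EuclideanSpace ℝ (Fin d)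

/-! ### Jacobi polynomials -/

/-- The Jacobi polynomial `P_n^{(a,b)}` with natural parameters `a, b`, by its standard explicit
formula `∑_s C(n+a, n-s) C(n+b, s) ((x-1)/2)^s ((x+1)/2)^(n-s)`. It is orthogonal to all polynomials
of degree `< n` on `[-1,1]` for the weight `(1-x)^a (1+x)^b`, and `P_n^{(a,b)}(1) = C(n+a, n)`. -/
def jacobi (a b n : ℕ) (x : ℝ) : ℝ :=
  ∑ s ∈ Finset.range (n + 1),
    ((n + a).choose (n - s) : ℝ) * ((n + b).choose s : ℝ) *
      ((x - 1) / 2) ^ s * ((x + 1) / 2) ^ (n - s)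

/-- The homogenized Jacobi polynomial: the polynomial in `(y, r)` that is formally written
`r^n P_n^{(a,b)}(2 y / r - 1)`; see `jacobiHom_eq`. -/
def jacobiHom (a b n : ℕ) (y r : ℝ) : ℝ :=
  ∑ s ∈ Finset.range (n + 1),
    ((n + a).choose (n - s) : ℝ) * ((n + b).choose s : ℝ) * (y - r) ^ s * y ^ (n - s)

theorem jacobi_one (a b n : ℕ) : jacobi a b n 1 = ((n + a).choose n : ℝ) := by
  unfold jacobi
  rw [Finset.sum_eq_single 0]
  · norm_num
  · intro s _ hs
    simp [hs]
  · simp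

theorem jacobiHom_eq (a b n : ℕ) (y r : ℝ) (hr : r ≠ 0) :
    jacobiHom a b n y r = r ^ n * jacobi a b n (2 * y / r - 1) := by
  unfold jacobiHom jacobi
  rw [Finset.mul_sum]
  refine Finset.sum_congr rfl fun s hs => ?_
  have hs' : s ≤ n := Nat.lt_succ_iff.mp (Finset.mem_range.mp hs)
  have h1 : (2 * y / r - 1 - 1) / 2 = (y - r) / r := by field_simp; ring
  have h2 : (2 * y / r - 1 + 1) / 2 = y / r := by field_simp; ring
  have h3 : r ^ n = r ^ s * r ^ (n - s) := by rw [← pow_add]; congr 1; omega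
  rw [h1, h2, h3, div_pow, div_pow]
  field_simp

/-- The polynomial `P_α^bary(y_0, …, y_ℓ)`, `α ∈ ℕ_0^ℓ`, i.e.
`∏_{j=1}^ℓ r_j^{α_j} P_{α_j}^{(s_j,1)}(2 y_j / r_j - 1)` with `r_j = y_0 + ∑_{m=j}^ℓ y_m` and
`s_j = 2 ∑_{m=j+1}^ℓ α_m + 2 (ℓ - j) + 1`. (The index `j : Fin ℓ` stands for `j + 1`.) -/
def orthoBary {ℓ : ℕ} (α : Fin ℓ → ℕ) (y : Fin (ℓ + 1) → ℝ) : ℝ :=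
  ∏ j : Fin ℓ,
    jacobiHom (2 * (∑ m ∈ Finset.Ioi j, α m) + 2 * (ℓ - (j.val + 1)) + 1) 1 (α j)
      (y j.succ) (y 0 + ∑ m ∈ Finset.Ici j, y m.succ)

/-! ### Domains and meshes -/

/-- The domains considered: connected, and equal to the interior of the closure. (With a finite
simplicial mesh, `Ω` is then a bounded polytopal domain; every connected bounded Lipschitz polytope
has these properties.) -/
structure IsMeshDomain {d : ℕ} (Ω : Set (E d)) : Prop where
  connected : IsConnected Ω
  regular : interior (closure Ω) = Ω

/-- A conforming simplicial finite element mesh of `Ω ⊆ ℝ^d`, with its simplicial complex of faces.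
A face is stored as its vertex set; the geometric closed face is the convex hull. -/
structure Mesh {d : ℕ} (Ω : Set (E d)) extends Geometry.SimplicialComplex ℝ (E d) where
  finite_faces : faces.Finite
  pure : ∀ τ ∈ faces, ∃ K ∈ faces, τ ⊆ K ∧ K.card = d + 1
  cover : (⋃ τ ∈ faces, convexHull ℝ (τ : Set (E d))) = closure Ω

/-- The closed simplex with vertex set `τ`. -/
def hull {d : ℕ} (τ : Finset (E d)) : Set (E d) := convexHull ℝ (τ : Set (E d))

/-- The face `τ` lies in `∂Ω`. -/
def OnBoundary {d : ℕ} (Ω : Set (E d)) (τ : Finset (E d)) : Prop := hull τ ⊆ frontier Ω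

namespace Mesh

variable {d : ℕ} {Ω : Set (E d)}

/-- The set `𝓢_ℓ` of `ℓ`-dimensional faces. -/
abbrev Face (T : Mesh Ω) (ℓ : ℕ) : Type := {τ : Finset (E d) // τ ∈ T.faces ∧ τ.card = ℓ + 1}

/-- The simplices `K ∈ 𝓣`. -/
abbrev Cell (T : Mesh Ω) : Type := T.Face d

/-- The facets `F ∈ 𝓕`. -/
abbrev Facet (T : Mesh Ω) : Type := T.Face (d - 1)

/-- The boundary facets `F ∈ 𝓕_{∂Ω}`. -/
abbrev BdryFacet (T : Mesh Ω) : Type := {F : T.Facet // OnBoundary Ω F.1}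

/-- Every face lies in a simplex of the mesh. -/
theorem exists_cell (T : Mesh Ω) {τ : Finset (E d)} (hτ : τ ∈ T.faces) :
    ∃ K : T.Cell, τ ⊆ K.1 := by
  obtain ⟨K, hK, h, hc⟩ := T.pure τ hτ
  exact ⟨⟨K, hK, hc⟩, h⟩

/-- The simplex adjacent to a facet; it is unique for a boundary facet, the only case in which
this is used. -/
def adj (T : Mesh Ω) (F : T.Facet) : T.Cell := (T.exists_cell F.2.1).choose

/-- The vertices of a simplex of the mesh as an affine basis of `ℝ^d`. -/
def cellBasis (T : Mesh Ω) (K : T.Cell) : AffineBasis K.1 ℝ (E d) where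
  toFun := fun z => z.1
  ind' := T.indep K.2.1
  tot' := by
    refine (T.indep K.2.1).affineSpan_eq_top_iff_card_eq_finrank_add_one.2 ?_
    simp [K.2.2]

/-- The barycentric coordinate `λ_{K,z}` of the simplex `K` for its vertex `z`, as an affine
function on `ℝ^d`; it is `0` when `z` is not a vertex of `K`. -/
def bary (T : Mesh Ω) (K : T.Cell) (z : E d) (x : E d) : ℝ :=
  if h : z ∈ K.1 then (T.cellBasis K).coord ⟨z, h⟩ x else 0

/-! ### Piecewise polynomials -/

/-- Piecewise defined functions `u = (u|_K)_{K ∈ 𝓣}`. A function in `ℙ_k(𝓣)` is given by the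
polynomials `u|_K` (a polynomial is determined by its values on the simplex `K`), which also encode
the one-sided values of `u` on `∂K`. -/
abbrev Broken (T : Mesh Ω) : Type := T.Cell → E d → ℝ

/-- `f` is a `d`-variate polynomial function of total degree at most `k`. -/
def IsPoly (k : ℕ) (f : E d → ℝ) : Prop :=
  ∃ p : MvPolynomial (Fin d) ℝ, p.totalDegree ≤ k ∧ ∀ x, f x = MvPolynomial.eval (fun i => x i) p

theorem IsPoly.add {k : ℕ} {f g : E d → ℝ} (hf : IsPoly k f) (hg : IsPoly k g) :
    IsPoly k (f + g) := by
  obtain ⟨p, hp, hp'⟩ := hf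
  obtain ⟨q, hq, hq'⟩ := hg
  exact ⟨p + q, (MvPolynomial.totalDegree_add p q).trans (max_le hp hq),
    fun x => by simp [hp', hq']⟩

theorem IsPoly.zero {k : ℕ} : IsPoly k (0 : E d → ℝ) := ⟨0, by simp, fun x => by simp⟩

theorem IsPoly.smul {k : ℕ} (c : ℝ) {f : E d → ℝ} (hf : IsPoly k f) : IsPoly k (c • f) := by
  obtain ⟨p, hp, hp'⟩ := hf
  exact ⟨c • p, (MvPolynomial.totalDegree_smul_le c p).trans hp,
    fun x => by simp [hp', MvPolynomial.smul_eval]⟩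

/-- The conforming space `S_k(𝓣)`: piecewise polynomials of degree at most `k` that are given by a
continuous function on the closure of `Ω`. -/
def S (T : Mesh Ω) (k : ℕ) : Submodule ℝ T.Broken where
  carrier := {u | (∀ K, IsPoly k (u K)) ∧ ∃ v : E d → ℝ, ContinuousOn v (closure Ω) ∧
    ∀ K : T.Cell, ∀ x ∈ hull K.1, u K x = v x}
  add_mem' := by
    rintro u₁ u₂ ⟨h₁, v₁, c₁, e₁⟩ ⟨h₂, v₂, c₂, e₂⟩
    exact ⟨fun K => (h₁ K).add (h₂ K), v₁ + v₂, c₁.add c₂,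
      fun K x hx => by simp [e₁ K x hx, e₂ K x hx]⟩
  zero_mem' := ⟨fun _ => IsPoly.zero, 0, continuousOn_const, fun _ _ _ => rfl⟩
  smul_mem' := by
    rintro c u ⟨h, v, hv, e⟩
    exact ⟨fun K => (h K).smul c, c • v, hv.const_smul c, fun K x hx => by simp [e K x hx]⟩

/-- The subspace `S_{k,0}(𝓣)` of the functions in `S_k(𝓣)` with zero trace on `∂Ω`. -/
def S0 (T : Mesh Ω) (k : ℕ) : Submodule ℝ T.Broken where
  carrier := {u | u ∈ T.S k ∧ ∀ K : T.Cell, ∀ x ∈ hull K.1, x ∈ frontier Ω → u K x = 0}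
  add_mem' := by
    rintro u₁ u₂ ⟨h₁, e₁⟩ ⟨h₂, e₂⟩
    exact ⟨(T.S k).add_mem h₁ h₂, fun K x hx hx' => by simp [e₁ K x hx hx', e₂ K x hx hx']⟩
  zero_mem' := ⟨(T.S k).zero_mem, fun _ _ _ _ => rfl⟩
  smul_mem' := by
    rintro c u ⟨h, e⟩
    exact ⟨(T.S k).smul_mem c h, fun K x hx hx' => by simp [e K x hx hx']⟩

/-! ### The Crouzeix-Raviart space -/

/-- The polynomial `(1/d) (-1 + ∑_{z ∈ 𝓥(K)} P_k^{(0,d-2)}(1 - 2 λ_{K,z}))`. -/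
def cellPoly (T : Mesh Ω) (k : ℕ) (K : T.Cell) (x : E d) : ℝ :=
  (1 / (d : ℝ)) * (-1 + ∑ z ∈ K.1, jacobi 0 (d - 2) k (1 - 2 * T.bary K z x))

/-- The non-conforming simplex function `B_k^{CR,K}`. -/
def crCell (T : Mesh Ω) (k : ℕ) (K : T.Cell) : T.Broken :=
  fun K' x => if K' = K then T.cellPoly k K x else 0

/-- `λ_{K,F}` for a facet `F` of `K`: the barycentric coordinate of `K` for the vertex opposite to
`F`, which is the only element of `K \ F`. -/
def oppBary (T : Mesh Ω) (K : T.Cell) (F : T.Facet) (x : E d) : ℝ :=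
  ∑ z ∈ K.1 \ F.1, T.bary K z x

/-- The non-conforming facet function `B_k^{CR,F}`. -/
def crFacet (T : Mesh Ω) (k : ℕ) (F : T.Facet) : T.Broken :=
  fun K x => if F.1 ⊆ K.1 then
    jacobi 0 (d - 2) k (1 - 2 * T.oppBary K F x) - T.cellPoly k K x else 0

/-- The canonical Crouzeix-Raviart space `CR_k(𝓣)`. -/
def CR (T : Mesh Ω) (k : ℕ) : Submodule ℝ T.Broken :=
  if Even k then T.S k ⊔ Submodule.span ℝ (range (T.crCell k))
  else T.S k ⊔ Submodule.span ℝ (range (T.crFacet k))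

/-- The canonical Crouzeix-Raviart space `CR_{k,0}(𝓣)` with zero boundary conditions. -/
def CR0 (T : Mesh Ω) (k : ℕ) : Submodule ℝ T.Broken :=
  if Even k then T.S0 k ⊔ Submodule.span ℝ (range (T.crCell k))
  else T.S0 k ⊔ Submodule.span ℝ (T.crFacet k '' {F | ¬ OnBoundary Ω F.1})

/-! ### The bases, for odd `k` -/

/-- A numbering `A_0(τ), …, A_ℓ(τ)` of the vertices of every face `τ`. -/
abbrev Numbering (T : Mesh Ω) : Type := ∀ (ℓ : ℕ) (τ : T.Face ℓ), Fin (ℓ + 1) ≃ τ.1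

/-- The index set `𝓘_k` for odd `k`: pairs `(τ, α)` of a face `τ` of dimension `ℓ ≥ 1` and a
multi-index `α ∈ ℕ_0^ℓ` with `|α| ≤ k - (ℓ + 1)`. -/
structure ConfIndex (T : Mesh Ω) (k : ℕ) where
  dim : ℕ
  face : T.Face dim
  α : Fin dim → ℕ
  one_le_dim : 1 ≤ dim
  degree_le : (∑ j, α j) + (dim + 1) ≤ k

/-- The hat function `φ_z^1` of the vertex `z`. -/
def hat (T : Mesh Ω) (z : E d) : T.Broken := fun K x => T.bary K z x

/-- The face bubble `W_τ`. -/
def bubble (T : Mesh Ω) (τ : Finset (E d)) : T.Broken := fun K x => ∏ z ∈ τ, T.hat z K x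

/-- The conforming basis function `B_{τ,α} = W_τ P_α^bary(φ_{A_0(τ)}^1, …, φ_{A_ℓ(τ)}^1)`. -/
def confBasis (T : Mesh Ω) (A : T.Numbering) {k : ℕ} (i : T.ConfIndex k) : T.Broken :=
  fun K x => T.bubble i.face.1 K x *
    orthoBary i.α (fun j => T.hat (A i.dim i.face j : E d) K x)

/-- The index set of the basis of `CR_k(𝓣)`: pairs `(τ, α)`, and facets. -/
abbrev FullIndex (T : Mesh Ω) (k : ℕ) : Type := T.ConfIndex k ⊕ T.Facet

/-- The index set of the basis of `CR_{k,0}(𝓣)`: the pairs `(τ, α)` with `τ ⊄ ∂Ω`, and the facets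
`F ∈ 𝓕_Ω`. -/
abbrev ZeroIndex (T : Mesh Ω) (k : ℕ) : Type :=
  {i : T.ConfIndex k // ¬ OnBoundary Ω i.face.1} ⊕ {F : T.Facet // ¬ OnBoundary Ω F.1}

/-- The inclusion of the second index set in the first. -/
def ZeroIndex.toFull {T : Mesh Ω} {k : ℕ} : T.ZeroIndex k → T.FullIndex k :=
  Sum.map Subtype.val Subtype.val

/-- The basis functions of `CR_k(𝓣)`, `k` odd. -/
def crBasis (T : Mesh Ω) (A : T.Numbering) (k : ℕ) : T.FullIndex k → T.Broken :=
  Sum.elim (T.confBasis A) (T.crFacet k)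

/-- The basis functions of `CR_{k,0}(𝓣)`, `k` odd. -/
def crBasis0 (T : Mesh Ω) (A : T.Numbering) (k : ℕ) : T.ZeroIndex k → T.Broken :=
  fun i => T.crBasis A k i.toFull

/-! ### The degrees of freedom -/

/-- The functional `u ↦ ∫_K g u`. -/
def cellInt (T : Mesh Ω) (K : T.Cell) (g : E d → ℝ) (u : T.Broken) : ℝ :=
  ∫ x in hull K.1, g x * u K x

/-- The functional `u ↦ ∫_F g u` for a facet `F` with adjacent simplex `K` (unique if `F ⊆ ∂Ω`): the
trace of `u|_K` on `F` is integrated with respect to the `(d-1)`-dimensional surface measure. -/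
def facetInt (T : Mesh Ω) (F : T.Facet) (g : E d → ℝ) (u : T.Broken) : ℝ :=
  ∫ x in hull F.1, g x * u (T.adj F) x ∂(Measure.hausdorffMeasure ((d : ℝ) - 1))

/-- A choice of weight functions: `cell K (τ, α) = g_{τ,α}^K`, `cellCR K F = g_F^{CR,K}` on the
simplices and `facet F (τ, α) = g_{τ,α}^F`, `facetCR F F' = g_{F'}^{CR,F}` on boundary facets. -/
structure Weights (T : Mesh Ω) (k : ℕ) where
  cell : T.Cell → T.ConfIndex k → E d → ℝ
  cellCR : T.Cell → T.Facet → E d → ℝ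
  facet : T.BdryFacet → T.ConfIndex k → E d → ℝ
  facetCR : T.BdryFacet → T.Facet → E d → ℝ

/-- The weights on the simplex `K` are square integrable, and their functionals are bidual to the
local basis on `K` formed by the restrictions `B_{t,β}|_K`, `t ⊆ K`, and `B_k^{CR,F}|_K`,
`F ∈ 𝓕(K)`. -/
structure Weights.DualOnCell {T : Mesh Ω} {k : ℕ} (w : T.Weights k) (A : T.Numbering)
    (K : T.Cell) : Prop where
  memLp : ∀ i : T.ConfIndex k, i.face.1 ⊆ K.1 →
    MemLp (w.cell K i) 2 (volume.restrict (hull K.1))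
  memLpCR : ∀ F : T.Facet, F.1 ⊆ K.1 → MemLp (w.cellCR K F) 2 (volume.restrict (hull K.1))
  conf_conf : ∀ i j : T.ConfIndex k, i.face.1 ⊆ K.1 → j.face.1 ⊆ K.1 →
    T.cellInt K (w.cell K i) (T.confBasis A j) = if i = j then 1 else 0
  conf_cr : ∀ (i : T.ConfIndex k) (F : T.Facet), i.face.1 ⊆ K.1 → F.1 ⊆ K.1 →
    T.cellInt K (w.cell K i) (T.crFacet k F) = 0
  cr_conf : ∀ (F : T.Facet) (j : T.ConfIndex k), F.1 ⊆ K.1 → j.face.1 ⊆ K.1 →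
    T.cellInt K (w.cellCR K F) (T.confBasis A j) = 0
  cr_cr : ∀ F F' : T.Facet, F.1 ⊆ K.1 → F'.1 ⊆ K.1 →
    T.cellInt K (w.cellCR K F) (T.crFacet k F') = if F = F' then 1 else 0

/-- The facets in `∂Ω` of the simplex adjacent to the boundary facet `F`. -/
def bdryFacetsAt (T : Mesh Ω) (F : T.BdryFacet) : Set T.Facet :=
  {F' | F'.1 ⊆ (T.adj F.1).1 ∧ OnBoundary Ω F'.1}

/-- The weights on the boundary facet `F`, with adjacent simplex `K`, are square integrable on `F`,
and their functionals are bidual to the traces on `F` of `B_{t,β}|_K`, `t ⊆ F`, and of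
`B_k^{CR,F'}|_K`, where `F'` runs through the facets of `K` in `∂Ω`. -/
structure Weights.DualOnFacet {T : Mesh Ω} {k : ℕ} (w : T.Weights k) (A : T.Numbering)
    (F : T.BdryFacet) : Prop where
  memLp : ∀ i : T.ConfIndex k, i.face.1 ⊆ F.1.1 →
    MemLp (w.facet F i) 2 ((Measure.hausdorffMeasure ((d : ℝ) - 1)).restrict (hull F.1.1))
  memLpCR : ∀ F' ∈ T.bdryFacetsAt F,
    MemLp (w.facetCR F F') 2 ((Measure.hausdorffMeasure ((d : ℝ) - 1)).restrict (hull F.1.1))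
  conf_conf : ∀ i j : T.ConfIndex k, i.face.1 ⊆ F.1.1 → j.face.1 ⊆ F.1.1 →
    T.facetInt F.1 (w.facet F i) (T.confBasis A j) = if i = j then 1 else 0
  conf_cr : ∀ i : T.ConfIndex k, i.face.1 ⊆ F.1.1 → ∀ F' ∈ T.bdryFacetsAt F,
    T.facetInt F.1 (w.facet F i) (T.crFacet k F') = 0
  cr_conf : ∀ F' ∈ T.bdryFacetsAt F, ∀ j : T.ConfIndex k, j.face.1 ⊆ F.1.1 →
    T.facetInt F.1 (w.facetCR F F') (T.confBasis A j) = 0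
  cr_cr : ∀ F' ∈ T.bdryFacetsAt F, ∀ F'' ∈ T.bdryFacetsAt F,
    T.facetInt F.1 (w.facetCR F F') (T.crFacet k F'') = if F' = F'' then 1 else 0

/-- The weights have the local biduality properties on all simplices and all boundary facets. -/
structure Weights.Admissible {T : Mesh Ω} {k : ℕ} (w : T.Weights k) (A : T.Numbering) : Prop where
  onCell : ∀ K, w.DualOnCell A K
  onFacet : ∀ F, w.DualOnFacet A F

/-- On every boundary facet `F`, with adjacent simplex `K`, the functionals `J_{τ,α}^F`, `τ ⊆ F`, and
`J_F^{CR,F}` also vanish at `B_k^{CR,F'}` for the facets `F'` of `K` that are not in `∂Ω`. -/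
def Weights.KillsInner {T : Mesh Ω} {k : ℕ} (w : T.Weights k) (F : T.BdryFacet) : Prop :=
  ∀ F' : T.Facet, F'.1 ⊆ (T.adj F.1).1 → ¬ OnBoundary Ω F'.1 →
    (∀ i : T.ConfIndex k, i.face.1 ⊆ F.1.1 → T.facetInt F.1 (w.facet F i) (T.crFacet k F') = 0) ∧
    T.facetInt F.1 (w.facetCR F F.1) (T.crFacet k F') = 0

/-- An assignment function `mark : 𝓢 → 𝓣 ∪ 𝓕_{∂Ω}`: it maps a face that is not in `∂Ω` to a simplex
containing it and a face in `∂Ω` to a boundary facet containing it. -/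
structure Marking (T : Mesh Ω) where
  mark : T.faces → T.Cell ⊕ T.BdryFacet
  inner : ∀ τ : T.faces, ¬ OnBoundary Ω τ.1 → ∃ K : T.Cell, mark τ = Sum.inl K ∧ τ.1 ⊆ K.1
  bdry : ∀ τ : T.faces, OnBoundary Ω τ.1 → ∃ F : T.BdryFacet, mark τ = Sum.inr F ∧ τ.1 ⊆ F.1.1

/-- The degrees of freedom of `CR_k(𝓣)`, `k` odd: for `(τ, α)` this is `J_{τ,α}^K` if
`mark τ = K ∈ 𝓣` and `J_{τ,α}^F` if `mark τ = F ∈ 𝓕_{∂Ω}`; for a facet `F` it is `J_F^{CR,K}` if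
`mark F = K ∈ 𝓣` and `J_F^{CR,F}` if `F ∈ 𝓕_{∂Ω}` (so that `mark F = F`). -/
def dof (T : Mesh Ω) {k : ℕ} (m : T.Marking) (w : T.Weights k) : T.FullIndex k → T.Broken → ℝ
  | Sum.inl i, u =>
    match m.mark ⟨i.face.1, i.face.2.1⟩ with
    | Sum.inl K => T.cellInt K (w.cell K i) u
    | Sum.inr F => T.facetInt F.1 (w.facet F i) u
  | Sum.inr F, u =>
    match m.mark ⟨F.1, F.2.1⟩ with
    | Sum.inl K => T.cellInt K (w.cellCR K F) u
    | Sum.inr F' => T.facetInt F'.1 (w.facetCR F' F) u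

/-- The degrees of freedom of `CR_{k,0}(𝓣)`, `k` odd. -/
def dof0 (T : Mesh Ω) {k : ℕ} (m : T.Marking) (w : T.Weights k) : T.ZeroIndex k → T.Broken → ℝ :=
  fun i => T.dof m w i.toFull

end Mesh

/-- `J` is a bidual basis for the basis `b` of `V`: `b` is a basis of `V`, the `J i` are linear
functionals on `V`, and `J_i (b_j) = δ_{ij}`. -/
structure IsBidual {ι X : Type*} [AddCommGroup X] [Module ℝ X] (V : Submodule ℝ X) (b : ι → X)
    (J : ι → X → ℝ) : Prop where
  linearIndependent : LinearIndependent ℝ b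
  span_eq : Submodule.span ℝ (range b) = V
  linear : ∃ L : ι → Module.Dual ℝ V, ∀ i (u : V), L i u = J i u
  dual : ∀ i j, J i (b j) = if i = j then 1 else 0

/-- The `J i` restrict to a basis of the dual space of `V`. -/
def IsDualSpaceBasis {ι X : Type*} [AddCommGroup X] [Module ℝ X] (V : Submodule ℝ X)
    (J : ι → X → ℝ) : Prop :=
  ∃ L : Module.Basis ι ℝ (Module.Dual ℝ V), ∀ i (u : V), L i u = J i u

end CRFem

end

noncomputable section

/-! Write C = binom(k+d-2, k). Since k is odd, P_k^{(0,d-2)} is 1 at 1 and -C at -1. At a vertex y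
of a cell, the function of the facet opposite z therefore has the value (1+C)(1/d - δ_{yz})
(`crFacet_vertex`), while each B_{τ,α} vanishes at all vertices and on every face that does not
contain τ. The matrix (1/d - δ_{yz}) of size d+1 is invertible. Without the row of one vertex, its
kernel is the line through the vector that is 0 at this vertex and 1 at the others. So the local
functions are independent on a cell, and on a facet of it as soon as one of the other facets is
dropped (`local_independent`). Among themselves the B_{τ,α} are independent by induction on the size
of τ and a comparison of leading terms of P_α^bary.

Spanning: the facet functions of all facets through a vertex z add up to the continuous function 1 -
P_k(1 - 2φ_z), which is (1+C)φ_z at the vertices (`vertexFun_eq_sum`). Subtracting such functions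
makes a continuous piecewise polynomial vanish at the vertices. Its Bernstein expansion then uses
only exponents whose support is a face of positive dimension, and there are at most as many of these
as functions B_{τ,α}; a dimension count concludes (`mem_span_of_mem_S`). A predicate `Q` on faces
treats both spaces at once: it is trivial for CR_k and means "not in ∂Ω" for CR_{k,0}. The latter
needs that the carrier of a boundary point lies in ∂Ω.

Weights: an independent finite family in L² has a dual family. On a boundary facet F of K this
requires a facet of K that is not in ∂Ω, which exists because Ω is connected and there are several
cells (`exists_inner_facet`). Let y be the vertex of K opposite F. The functions of the facets other
than F add up to zero on F, since λ_y = 0 there; so a functional that kills all of them but one also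
kills the last, and compatible weights exist (`exists_facet_weights`).

Biduality globalizes because a basis function not attached to mark(τ) vanishes there. For facet
weights that are not compatible, the only entries that can be wrong pair a boundary functional with
an inner facet function; the matrix is then still block triangular with identity diagonal blocks,
which gives a basis of the dual space. -/

namespace CRFem

/-! ### Linear independence of the polynomials P_α^bary. -/

open scoped MonomialOrder in
theorem linearIndependent_of_monomialOrder_degree_injective {σ ι : Type*} (m : MonomialOrder σ)
    (q : ι → MvPolynomial σ ℝ) (h0 : ∀ i, q i ≠ 0)
    (hinj : Function.Injective fun i => m.degree (q i)) : LinearIndependent ℝ q := by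
  rw [linearIndependent_iff']
  intro s c hc
  by_contra! hne
  obtain ⟨i₀, hi₀, hc₀⟩ := hne
  have hne' : (s.filter fun i => c i ≠ 0).Nonempty := ⟨i₀, by simp [hi₀, hc₀]⟩
  -- The largest leading exponent with nonzero coefficient occurs only once, so it cannot cancel.
  obtain ⟨i, hi, hmax⟩ := Finset.exists_max_image (s.filter fun i => c i ≠ 0)
    (fun i => m.toSyn (m.degree (q i))) hne'
  have hcoeff := congrArg (MvPolynomial.coeff (m.degree (q i))) hc
  rw [MvPolynomial.coeff_sum, MvPolynomial.coeff_zero, Finset.sum_eq_single i] at hcoeff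
  · rw [MvPolynomial.coeff_smul, smul_eq_mul] at hcoeff
    rcases mul_eq_zero.1 hcoeff with h | h
    · exact (Finset.mem_filter.1 hi).2 h
    · exact h0 i (m.leadingCoeff_eq_zero_iff.1 h)
  · intro j hj hji
    rw [MvPolynomial.coeff_smul, smul_eq_mul]
    by_cases hcj : c j = 0
    · rw [hcj, zero_mul]
    · rw [m.coeff_eq_zero_of_lt, mul_zero]
      refine lt_of_le_of_ne (hmax j (by simp [hj, hcj])) fun h => hji ?_
      exact hinj (m.toSyn.injective h)
  · intro h
    exact absurd (Finset.mem_filter.1 hi).1 h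

/-- The homogenized Jacobi polynomial of two elements of a commutative algebra. -/
def jacobiHomAlg {R : Type*} [CommRing R] [Algebra ℝ R] (a b n : ℕ) (y r : R) : R :=
  ∑ s ∈ Finset.range (n + 1),
    (((n + a).choose (n - s) : ℝ) * ((n + b).choose s : ℝ)) • ((y - r) ^ s * y ^ (n - s))

/-- Naturality lets one formula serve for formal polynomials, for polynomials in hat functions and
for real values. -/
theorem map_jacobiHomAlg {R S : Type*} [CommRing R] [Algebra ℝ R] [CommRing S] [Algebra ℝ S]
    (f : R →ₐ[ℝ] S) (a b n : ℕ) (y r : R) :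
    f (jacobiHomAlg a b n y r) = jacobiHomAlg a b n (f y) (f r) := by
  simp [jacobiHomAlg, map_sum]

theorem jacobiHomAlg_real (a b n : ℕ) (y r : ℝ) :
    jacobiHomAlg a b n y r = jacobiHom a b n y r := by
  simp only [jacobiHomAlg, jacobiHom, smul_eq_mul, mul_assoc]

/-- `P_α^bary` evaluated at elements of a commutative algebra. -/
def orthoBaryAlg {R : Type*} [CommRing R] [Algebra ℝ R] {ℓ : ℕ} (α : Fin ℓ → ℕ)
    (y : Fin (ℓ + 1) → R) : R :=
  ∏ j : Fin ℓ,
    jacobiHomAlg (2 * (∑ m ∈ Finset.Ioi j, α m) + 2 * (ℓ - (j.val + 1)) + 1) 1 (α j)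
      (y j.succ) (y 0 + ∑ m ∈ Finset.Ici j, y m.succ)

theorem map_orthoBaryAlg {R S : Type*} [CommRing R] [Algebra ℝ R] [CommRing S] [Algebra ℝ S]
    (f : R →ₐ[ℝ] S) {ℓ : ℕ} (α : Fin ℓ → ℕ) (y : Fin (ℓ + 1) → R) :
    f (orthoBaryAlg α y) = orthoBaryAlg α (f ∘ y) := by
  simp [orthoBaryAlg, map_prod, map_jacobiHomAlg]

theorem orthoBaryAlg_real {ℓ : ℕ} (α : Fin ℓ → ℕ) (y : Fin (ℓ + 1) → ℝ) :
    orthoBaryAlg α y = orthoBary α y := by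
  simp only [orthoBaryAlg, orthoBary, jacobiHomAlg_real]

theorem totalDegree_jacobiHomAlg_le {σ : Type*} (a b n : ℕ) {y r : MvPolynomial σ ℝ}
    (hy : y.totalDegree ≤ 1) (hr : r.totalDegree ≤ 1) :
    (jacobiHomAlg a b n y r).totalDegree ≤ n := by
  refine MvPolynomial.totalDegree_finsetSum_le fun s hs => ?_
  have hs' : s ≤ n := Nat.lt_succ_iff.mp (Finset.mem_range.mp hs)
  refine (MvPolynomial.totalDegree_smul_le _ _).trans ((MvPolynomial.totalDegree_mul _ _).trans ?_)
  have h1 : ((y - r) ^ s).totalDegree ≤ s * 1 := (MvPolynomial.totalDegree_pow _ _).trans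
    (Nat.mul_le_mul_left _ ((MvPolynomial.totalDegree_sub _ _).trans (max_le hy hr)))
  have h2 : (y ^ (n - s)).totalDegree ≤ (n - s) * 1 := (MvPolynomial.totalDegree_pow _ _).trans
    (Nat.mul_le_mul_left _ hy)
  omega

theorem totalDegree_orthoBaryAlg_le {σ : Type*} {ℓ : ℕ} (α : Fin ℓ → ℕ)
    {y : Fin (ℓ + 1) → MvPolynomial σ ℝ} (hy : ∀ i, (y i).totalDegree ≤ 1) :
    (orthoBaryAlg α y).totalDegree ≤ ∑ j, α j := by
  refine (MvPolynomial.totalDegree_finsetProd _ _).trans (Finset.sum_le_sum fun j _ => ?_)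
  refine totalDegree_jacobiHomAlg_le _ _ _ (hy _) ((MvPolynomial.totalDegree_add _ _).trans ?_)
  exact max_le (hy _) (MvPolynomial.totalDegree_finsetSum_le fun m _ => hy _)

section Leading

open scoped MonomialOrder

variable {σ : Type*} (m : MonomialOrder σ)

/-- If `r` is of lower order than the variable `X i`, then the leading term of
`jacobiHomAlg a b n (X i) r` is a nonzero multiple of `X i ^ n`. -/
theorem degree_jacobiHomAlg (a b n : ℕ) (i : σ) (r : MvPolynomial σ ℝ)
    (hr : m.degree r ≺[m] Finsupp.single i 1) :
    jacobiHomAlg a b n (MvPolynomial.X i) r ≠ 0 ∧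
      m.degree (jacobiHomAlg a b n (MvPolynomial.X i) r) = n • Finsupp.single i 1 := by
  have hX : m.degree (MvPolynomial.X i : MvPolynomial σ ℝ) = Finsupp.single i 1 := m.degree_X
  have hmon : m.Monic (MvPolynomial.X i - r) := by
    rw [sub_eq_add_neg]
    refine m.monic_X.add_of_lt ?_
    rwa [hX, m.degree_neg]
  have hdeg : m.degree (MvPolynomial.X i - r) = Finsupp.single i 1 := by
    rw [sub_eq_add_neg, m.degree_add_of_lt, hX]
    rwa [hX, m.degree_neg]
  have hterm : ∀ s ∈ Finset.range (n + 1),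
      m.Monic ((MvPolynomial.X i - r) ^ s * MvPolynomial.X i ^ (n - s)) ∧
      m.degree ((MvPolynomial.X i - r) ^ s * MvPolynomial.X i ^ (n - s)) =
        n • Finsupp.single i 1 := by
    intro s hs
    have hs' : s ≤ n := Nat.lt_succ_iff.mp (Finset.mem_range.mp hs)
    have h1 := hmon.pow (n := s)
    have h2 := (m.monic_X (R := ℝ) (s := i)).pow (n := n - s)
    refine ⟨h1.mul h2, ?_⟩
    rw [m.degree_mul h1.ne_zero h2.ne_zero, m.degree_pow, m.degree_pow, hdeg, hX, ← add_smul]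
    congr 1
    omega
  have hle : m.degree (jacobiHomAlg a b n (MvPolynomial.X i) r) ≼[m]
      n • (Finsupp.single i 1 : σ →₀ ℕ) := by
    unfold jacobiHomAlg
    refine (m.degree_sum_le).trans ?_
    refine Finset.sup_le fun s hs => ?_
    refine (m.degree_smul_le).trans ?_
    rw [(hterm s hs).2]
  -- Every summand has the same leading monomial, with a positive binomial coefficient, so nothing
  -- cancels.
  have hcoeff : 0 < (jacobiHomAlg a b n (MvPolynomial.X i) r).coeff
      (n • Finsupp.single i 1) := by
    unfold jacobiHomAlg
    rw [MvPolynomial.coeff_sum]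
    refine Finset.sum_pos (fun s hs => ?_) (by simp)
    have hs' : s ≤ n := Nat.lt_succ_iff.mp (Finset.mem_range.mp hs)
    rw [MvPolynomial.coeff_smul, ← (hterm s hs).2, (hterm s hs).1.coeff_degree, smul_eq_mul,
      mul_one]
    have h1 : 0 < (n + a).choose (n - s) := Nat.choose_pos (by omega)
    have h2 : 0 < (n + b).choose s := Nat.choose_pos (by omega)
    positivity
  have hne : jacobiHomAlg a b n (MvPolynomial.X i) r ≠ 0 := by
    intro h
    rw [h] at hcoeff
    simp at hcoeff
  refine ⟨hne, m.toSyn.injective (le_antisymm hle ?_)⟩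
  exact m.le_degree (MvPolynomial.mem_support_iff.2 hcoeff.ne')

end Leading

/-- The polynomials obtained from `P_α^bary` by eliminating `y_0 = 1 - ∑ y_j`, in the variables
`X i = y_{ℓ - i}`. -/
def orthoPoly {ℓ : ℕ} (α : Fin ℓ → ℕ) : MvPolynomial (Fin ℓ) ℝ :=
  orthoBaryAlg α (Fin.cons (1 - ∑ i, MvPolynomial.X i) fun j => MvPolynomial.X j.rev)

-- After the elimination of y_0 one has r_j = 1 - ∑_{m<j} y_m, which involves only variables of
-- lower order than y_j. The leading monomial is thus ∏ y_j^{α_j}, which determines α.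
open scoped MonomialOrder in
theorem degree_orthoPoly {ℓ : ℕ} (α : Fin ℓ → ℕ) :
    orthoPoly α ≠ 0 ∧ ∀ i, MonomialOrder.lex.degree (orthoPoly α) i = α i.rev := by
  set m : MonomialOrder (Fin ℓ) := MonomialOrder.lex with hm
  have key : ∀ j : Fin ℓ, ∀ r : MvPolynomial (Fin ℓ) ℝ, r = (1 - ∑ i, MvPolynomial.X i) +
      ∑ k ∈ Finset.Ici j, MvPolynomial.X k.rev → m.degree r ≺[m] Finsupp.single j.rev 1 := by
    intro j r hr
    have hr' : r = 1 - ∑ k ∈ Finset.Iio j, MvPolynomial.X k.rev := by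
      rw [hr, ← Equiv.sum_comp Fin.revPerm, ← Finset.sum_filter_add_sum_filter_not
        (Finset.univ) (fun k => j ≤ k)]
      have e1 : Finset.univ.filter (fun k => j ≤ k) = Finset.Ici j := by ext; simp
      have e2 : Finset.univ.filter (fun k => ¬ j ≤ k) = Finset.Iio j := by ext; simp
      rw [e1, e2]
      simp only [Fin.revPerm_apply]
      ring
    have hpos : (0 : Fin ℓ →₀ ℕ) ≺[m] Finsupp.single j.rev 1 := by
      rw [map_zero]
      refine bot_lt_iff_ne_bot.2 ?_
      change m.toSyn _ ≠ 0
      simp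
    have hlt : ∀ k ∈ Finset.Iio j, m.degree (MvPolynomial.X k.rev : MvPolynomial (Fin ℓ) ℝ) ≺[m]
        Finsupp.single j.rev 1 := by
      intro k hk
      -- In the lexicographic order the variable of smaller index is the larger one; this is the
      -- reason for the reversal.
      rw [m.degree_X, hm, MonomialOrder.lex_lt_iff, Finsupp.Lex.single_lt_iff]
      exact Fin.rev_lt_rev.2 (Finset.mem_Iio.1 hk)
    rw [hr']
    refine (m.degree_sub_le).trans_lt ?_
    rw [sup_lt_iff]
    refine ⟨by simpa using hpos, (m.degree_sum_le).trans_lt ?_⟩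
    rw [Finset.sup_lt_iff]
    · exact hlt
    · simpa using hpos
  have hfac := fun j : Fin ℓ => degree_jacobiHomAlg m
    (2 * (∑ m ∈ Finset.Ioi j, α m) + 2 * (ℓ - (j.val + 1)) + 1) 1 (α j) j.rev _ (key j _ rfl)
  have heq : orthoPoly α = ∏ j : Fin ℓ, jacobiHomAlg
      (2 * (∑ m ∈ Finset.Ioi j, α m) + 2 * (ℓ - (j.val + 1)) + 1) 1 (α j)
      (MvPolynomial.X j.rev)
      ((1 - ∑ i, MvPolynomial.X i) + ∑ k ∈ Finset.Ici j, MvPolynomial.X k.rev) := by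
    simp only [orthoPoly, orthoBaryAlg, Fin.cons_succ, Fin.cons_zero]
  constructor
  · rw [heq]
    exact Finset.prod_ne_zero_iff.2 fun j _ => (hfac j).1
  · intro i
    have : m.degree (orthoPoly α) = ∑ j : Fin ℓ, α j • Finsupp.single j.rev 1 := by
      rw [heq, m.degree_prod fun j _ => (hfac j).1]
      exact Finset.sum_congr rfl fun j _ => (hfac j).2
    rw [this, Finsupp.finsetSum_apply, Finset.sum_eq_single i.rev]
    · simp
    · intro j _ hj
      have : j.rev ≠ i := fun h => hj (by rw [← h, Fin.rev_rev])
      simp [this]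
    · simp

theorem linearIndependent_orthoPoly (ℓ : ℕ) :
    LinearIndependent ℝ (orthoPoly : (Fin ℓ → ℕ) → MvPolynomial (Fin ℓ) ℝ) := by
  refine linearIndependent_of_monomialOrder_degree_injective MonomialOrder.lex _
    (fun α => (degree_orthoPoly α).1) fun α β h => ?_
  funext j
  have h' := DFunLike.congr_fun h j.rev
  simpa [(degree_orthoPoly _).2] using h'

/-- The polynomials `P_α^bary` are linearly independent on the interior of the unit simplex. -/
theorem orthoBary_independent {ℓ : ℕ} (s : Finset (Fin ℓ → ℕ)) (c : (Fin ℓ → ℕ) → ℝ)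
    (h : ∀ y : Fin (ℓ + 1) → ℝ, (∀ i, 0 < y i) → ∑ i, y i = 1 →
      ∑ α ∈ s, c α * orthoBary α y = 0) : ∀ α ∈ s, c α = 0 := by
  refine linearIndependent_iff'.1 (linearIndependent_orthoPoly ℓ) s c ?_
  -- This box lies in the open simplex, and a polynomial that vanishes on a product of infinite sets
  -- is zero.
  refine MvPolynomial.funext_set (fun _ => Set.Ioo (0 : ℝ) (1 / (ℓ + 1))) (fun _ =>
    Set.Ioo_infinite (by positivity)) fun x hx => ?_
  have hx' : ∀ i, 0 < x i ∧ x i < 1 / (ℓ + 1) := fun i => hx i (mem_univ i)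
  have hsum : ∑ i, x i < 1 := by
    have h1 : ∑ i, x i ≤ ∑ _i : Fin ℓ, (1 / (ℓ + 1) : ℝ) :=
      Finset.sum_le_sum fun i _ => (hx' i).2.le
    refine h1.trans_lt ?_
    rw [Finset.sum_const, Finset.card_univ, Fintype.card_fin, nsmul_eq_mul, mul_one_div,
      div_lt_one (by positivity)]
    linarith
  have hrev : ∑ j : Fin ℓ, x j.rev = ∑ j, x j := Equiv.sum_comp Fin.revPerm x
  have := h (Fin.cons (1 - ∑ i, x i) fun j => x j.rev) (fun i => ?_) ?_
  · rw [map_zero, map_sum, ← this]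
    refine Finset.sum_congr rfl fun α _ => ?_
    rw [MvPolynomial.smul_eval, ← orthoBaryAlg_real, orthoPoly]
    congr 1
    change MvPolynomial.aeval x _ = _
    rw [map_orthoBaryAlg]
    congr 1
    funext i
    refine Fin.cases ?_ (fun j => ?_) i <;> simp
  · refine Fin.cases ?_ (fun j => ?_) i
    · simpa using hsum
    · simpa using (hx' j.rev).1
  · rw [Fin.sum_univ_succ]
    simp [hrev]

/-! ### Faces, cells and the geometry of the mesh. -/

namespace Mesh

variable {d : ℕ} {Ω : Set (E d)} (T : Mesh Ω)

instance finite_face (ℓ : ℕ) : Finite (T.Face ℓ) :=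
  (T.finite_faces.subset fun _ h => h.1 : {τ | τ ∈ T.faces ∧ τ.card = ℓ + 1}.Finite)

theorem nonempty_of_mem_faces {τ : Finset (E d)} (hτ : τ ∈ T.faces) : τ.Nonempty :=
  T.toSimplicialComplex.nonempty_of_mem_faces hτ

theorem closure_eq_iUnion_cell : closure Ω = ⋃ K : T.Cell, hull K.1 := by
  rw [← T.cover]
  ext x
  simp only [mem_iUnion]
  constructor
  · rintro ⟨τ, hτ, hx⟩
    obtain ⟨K, hK⟩ := T.exists_cell hτ
    exact ⟨K, convexHull_mono (Finset.coe_subset.2 hK) hx⟩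
  · rintro ⟨K, hx⟩
    exact ⟨K.1, K.2.1, hx⟩

theorem hull_subset_closure (K : T.Cell) : hull K.1 ⊆ closure Ω := by
  rw [T.closure_eq_iUnion_cell]
  exact subset_iUnion (fun K : T.Cell => hull K.1) K

theorem _root_.CRFem.isCompact_hull (τ : Finset (E d)) : IsCompact (hull τ) :=
  τ.finite_toSet.isCompact_convexHull (𝕜 := ℝ)

theorem _root_.CRFem.hull_mono {σ τ : Finset (E d)} (h : σ ⊆ τ) : hull σ ⊆ hull τ :=
  convexHull_mono (Finset.coe_subset.2 h)

theorem _root_.CRFem.mem_hull_of_mem {τ : Finset (E d)} {z : E d} (h : z ∈ τ) : z ∈ hull τ :=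
  subset_convexHull ℝ _ (Finset.mem_coe.2 h)

theorem _root_.CRFem.OnBoundary.mono {σ τ : Finset (E d)} (h : σ ⊆ τ) (hτ : OnBoundary Ω τ) :
    OnBoundary Ω σ :=
  (hull_mono h).trans hτ

/-! ### Barycentric coordinates -/

theorem bary_of_mem (K : T.Cell) {z : E d} (h : z ∈ K.1) (x : E d) :
    T.bary K z x = (T.cellBasis K).coord ⟨z, h⟩ x := by
  rw [bary, dif_pos h]

theorem bary_of_notMem (K : T.Cell) {z : E d} (h : z ∉ K.1) (x : E d) : T.bary K z x = 0 := by
  rw [bary, dif_neg h]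

theorem continuous_bary (K : T.Cell) (z : E d) : Continuous (T.bary K z) := by
  by_cases h : z ∈ K.1
  · rw [show T.bary K z = (T.cellBasis K).coord ⟨z, h⟩ from funext (T.bary_of_mem K h)]
    exact continuous_barycentric_coord _ _
  · rw [show T.bary K z = fun _ => 0 from funext (T.bary_of_notMem K h)]
    exact continuous_const

theorem sum_bary (K : T.Cell) (x : E d) : ∑ z ∈ K.1, T.bary K z x = 1 := by
  rw [← (T.cellBasis K).sum_coord_apply_eq_one x, ← Finset.sum_coe_sort]
  exact Finset.sum_congr rfl fun z _ => T.bary_of_mem K z.2 x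

theorem sum_bary_smul (K : T.Cell) (x : E d) : ∑ z ∈ K.1, T.bary K z x • z = x := by
  conv_rhs => rw [← (T.cellBasis K).linear_combination_coord_eq_self x]
  rw [← Finset.sum_coe_sort]
  exact Finset.sum_congr rfl fun z _ => by rw [T.bary_of_mem K z.2 x]; rfl

theorem bary_sum_smul (K : T.Cell) {σ : Finset (E d)} (hσ : σ ⊆ K.1) (w : E d → ℝ)
    (hw : ∑ y ∈ σ, w y = 1) (z : E d) :
    T.bary K z (∑ y ∈ σ, w y • y) = if z ∈ σ then w z else 0 := by
  by_cases hz : z ∈ K.1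
  · have h1 : ∑ y : K.1, (if (y : E d) ∈ σ then w y else 0) = 1 := by
      rw [Finset.sum_coe_sort K.1 (fun y => if y ∈ σ then w y else 0), ← Finset.sum_filter,
        Finset.filter_mem_eq_inter, Finset.inter_eq_right.2 hσ, hw]
    have h2 : ∑ y ∈ σ, w y • y = Finset.univ.affineCombination ℝ (T.cellBasis K)
        (fun y => if (y : E d) ∈ σ then w y else 0) := by
      rw [Finset.affineCombination_eq_linear_combination _ _ _ h1]
      change _ = ∑ y : K.1, (if (y : E d) ∈ σ then w y else 0) • (y : E d)
      rw [Finset.sum_coe_sort K.1 (fun y => (if y ∈ σ then w y else 0) • y)]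
      simp only [ite_smul, zero_smul]
      rw [← Finset.sum_filter, Finset.filter_mem_eq_inter, Finset.inter_eq_right.2 hσ]
    rw [T.bary_of_mem K hz, h2,
      (T.cellBasis K).coord_apply_combination_of_mem (Finset.mem_univ _) h1]
  · rw [T.bary_of_notMem K hz, if_neg fun h => hz (hσ h)]

theorem bary_vertex (K : T.Cell) {y : E d} (hy : y ∈ K.1) (z : E d) :
    T.bary K z y = if z = y then 1 else 0 := by
  have := T.bary_sum_smul K (σ := {y}) (by simpa using hy) (fun _ => 1) (by simp) z
  simpa using this

theorem mem_hull_iff (K : T.Cell) {σ : Finset (E d)} (hσ : σ ⊆ K.1) {x : E d} :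
    x ∈ hull σ ↔ (∀ z, 0 ≤ T.bary K z x) ∧ ∀ z, z ∉ σ → T.bary K z x = 0 := by
  rw [hull, Finset.mem_convexHull']
  constructor
  · rintro ⟨w, hw0, hw1, rfl⟩
    simp only [T.bary_sum_smul K hσ w hw1]
    refine ⟨fun z => ?_, fun z hz => by rw [if_neg hz]⟩
    split_ifs with h
    exacts [hw0 z h, le_rfl]
  · rintro ⟨h0, h1⟩
    refine ⟨fun z => T.bary K z x, fun z _ => h0 z, ?_, ?_⟩
    · rw [← T.sum_bary K x]
      exact Finset.sum_subset hσ fun z _ hz => h1 z hz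
    · conv_rhs => rw [← T.sum_bary_smul K x]
      exact Finset.sum_subset hσ fun z _ hz => by simp only [h1 z hz, zero_smul]

theorem mem_hull_cell_iff (K : T.Cell) {x : E d} : x ∈ hull K.1 ↔ ∀ z, 0 ≤ T.bary K z x := by
  rw [T.mem_hull_iff K Finset.Subset.rfl]
  exact ⟨fun h => h.1, fun h => ⟨h, fun z hz => T.bary_of_notMem K hz x⟩⟩

theorem mem_hull_inter {K K' : T.Cell} {x : E d} (hx : x ∈ hull K.1) (hx' : x ∈ hull K'.1) :
    x ∈ hull (K.1 ∩ K'.1) := by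
  have := T.inter_subset_convexHull K.2.1 K'.2.1 ⟨hx, hx'⟩
  rwa [hull, Finset.coe_inter]

/-- Conformity: a point of two cells is a convex combination of their common vertices, and both
coordinate systems read off its weights. -/
theorem bary_eq_of_mem {K K' : T.Cell} {x : E d} (hx : x ∈ hull K.1) (hx' : x ∈ hull K'.1)
    (z : E d) : T.bary K z x = T.bary K' z x := by
  have h := T.mem_hull_inter hx hx'
  rw [hull, Finset.mem_convexHull'] at h
  obtain ⟨w, -, hw1, rfl⟩ := h
  rw [T.bary_sum_smul K Finset.inter_subset_left w hw1,
    T.bary_sum_smul K' Finset.inter_subset_right w hw1]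

theorem bary_add_sub (K : T.Cell) (z x y v : E d) :
    T.bary K z (x + v) - T.bary K z x = T.bary K z (y + v) - T.bary K z y := by
  by_cases h : z ∈ K.1
  · simp only [T.bary_of_mem K h]
    have := fun p : E d => (((T.cellBasis K).coord ⟨z, h⟩).map_vadd p v)
    simp only [vadd_eq_add, add_comm v] at this
    rw [this x, this y]
    ring
  · simp only [T.bary_of_notMem K h]

theorem bary_convex (K : T.Cell) (z x y : E d) (t : ℝ) :
    T.bary K z (AffineMap.lineMap x y t) = (1 - t) * T.bary K z x + t * T.bary K z y := by
  by_cases h : z ∈ K.1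
  · simp only [T.bary_of_mem K h]
    rw [AffineMap.apply_lineMap, AffineMap.lineMap_apply_module]
    simp
  · simp only [T.bary_of_notMem K h]
    ring

/-! ### Faces and the boundary of the domain -/

/-- The mesh looks alike near any two points with the same carrier. For small v, a cell K'
containing y + v contains y, hence also x. Coordinates of K' that are positive at x stay positive at
x + v; those that vanish at x also vanish at y, so they take the same value at x + v as at y + v. -/
theorem mem_interior_closure_of_same_carrier {K : T.Cell} {x y : E d} (hx : x ∈ hull K.1)
    (hy : y ∈ hull K.1) (hxy : ∀ z, T.bary K z x = 0 ↔ T.bary K z y = 0)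
    (h : y ∈ interior (closure Ω)) : x ∈ interior (closure Ω) := by
  rw [mem_interior_iff_mem_nhds] at h ⊢
  rw [← map_add_left_nhds_zero, Filter.mem_map] at h ⊢
  have h1 : ∀ᶠ v in nhds (0 : E d), ∀ K' : T.Cell, y ∉ hull K'.1 → y + v ∉ hull K'.1 := by
    rw [Filter.eventually_all]
    intro K'
    by_cases hK' : y ∈ hull K'.1
    · exact Filter.Eventually.of_forall fun v hv => absurd hK' hv
    · have hopen : IsOpen ((fun v => y + v) ⁻¹' (hull K'.1)ᶜ) :=
        (isCompact_hull K'.1).isClosed.isOpen_compl.preimage (by fun_prop)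
      filter_upwards [hopen.mem_nhds (by simpa using hK')] with v hv _ using hv
  have h2 : ∀ᶠ v in nhds (0 : E d), ∀ K' : T.Cell, ∀ z : K'.1, 0 < T.bary K' z x →
      0 < T.bary K' z (x + v) := by
    rw [Filter.eventually_all]
    intro K'
    rw [Filter.eventually_all]
    intro z
    by_cases hz : 0 < T.bary K' z x
    · have hopen : IsOpen ((fun v => T.bary K' z (x + v)) ⁻¹' Ioi 0) :=
        isOpen_Ioi.preimage ((T.continuous_bary K' z).comp (by fun_prop))
      filter_upwards [hopen.mem_nhds (by simpa using hz)] with v hv _ using hv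
    · exact Filter.Eventually.of_forall fun v hv => absurd hv hz
  filter_upwards [h, h1, h2] with v hv0 hv1 hv2
  simp only [mem_preimage] at hv0 ⊢
  rw [T.closure_eq_iUnion_cell, mem_iUnion] at hv0
  obtain ⟨K', hK'⟩ := hv0
  have hyK' : y ∈ hull K'.1 := by
    by_contra hn
    exact hv1 K' hn hK'
  have hxK' : x ∈ hull K'.1 := by
    have h3 := (T.mem_hull_iff K Finset.inter_subset_left).1 (T.mem_hull_inter hy hyK')
    refine hull_mono Finset.inter_subset_right ((T.mem_hull_iff K
      (Finset.inter_subset_left (s₂ := K'.1))).2 ⟨(T.mem_hull_cell_iff K).1 hx, fun z hz => ?_⟩)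
    exact (hxy z).2 (h3.2 z hz)
  refine T.hull_subset_closure K' ((T.mem_hull_cell_iff K').2 fun z => ?_)
  by_cases hz : z ∈ K'.1
  · rcases ((T.mem_hull_cell_iff K').1 hxK' z).lt_or_eq with hpos | hzero
    · exact (hv2 K' ⟨z, hz⟩ hpos).le
    · have hy0 : T.bary K' z y = 0 := by
        rw [T.bary_eq_of_mem hyK' hy, ← hxy z, ← T.bary_eq_of_mem hxK' hx, ← hzero]
      have := T.bary_add_sub K' z x y v
      rw [← hzero, hy0, sub_zero, sub_zero] at this
      rw [this]
      exact (T.mem_hull_cell_iff K').1 hK' z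
  · rw [T.bary_of_notMem K' hz]

/-- The smallest face containing a boundary point is contained in the boundary. -/
theorem onBoundary_of_bary_ne_zero (hΩ : IsMeshDomain Ω) {K : T.Cell} {x : E d}
    (hx : x ∈ hull K.1) (hxf : x ∈ frontier Ω) {σ : Finset (E d)} (hσ : σ ⊆ K.1)
    (hpos : ∀ z ∈ σ, T.bary K z x ≠ 0) : OnBoundary Ω σ := by
  have hreg : interior Ω = interior (closure Ω) := by
    rw [hΩ.regular]
    conv_lhs => rw [← hΩ.regular, interior_interior, hΩ.regular]
  -- The vertices of the carrier of x.
  set ρ : Finset (E d) := K.1.filter fun z => T.bary K z x ≠ 0 with hρ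
  have hρK : ρ ⊆ K.1 := Finset.filter_subset _ _
  have hρ0 : ∀ z, z ∉ ρ → T.bary K z x = 0 := by
    intro z hz
    by_cases hzK : z ∈ K.1
    · by_contra h
      exact hz (Finset.mem_filter.2 ⟨hzK, h⟩)
    · exact T.bary_of_notMem K hzK x
  have hxn := (T.mem_hull_cell_iff K).1 hx
  refine OnBoundary.mono (τ := ρ) (fun z hz => Finset.mem_filter.2 ⟨hσ hz, hpos z hz⟩) ?_
  intro y hy
  have hy' := (T.mem_hull_iff K hρK).1 hy
  -- Every point of the segment except y has the carrier of x, so it is a boundary point; the point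
  -- y follows because the frontier is closed.
  have key : ∀ t ∈ Ioc (0 : ℝ) 1, AffineMap.lineMap y x t ∈ frontier Ω := by
    intro t ht
    set p := AffineMap.lineMap y x t with hp
    have hpb : ∀ z, T.bary K z p = (1 - t) * T.bary K z y + t * T.bary K z x :=
      fun z => T.bary_convex K z y x t
    have hpK : p ∈ hull K.1 := (T.mem_hull_cell_iff K).2 fun z => by
      rw [hpb]
      exact add_nonneg (mul_nonneg (by linarith [ht.2]) (hy'.1 z)) (mul_nonneg ht.1.le (hxn z))
    refine ⟨T.hull_subset_closure K hpK, fun hint => hxf.2 ?_⟩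
    rw [hreg] at hint ⊢
    refine T.mem_interior_closure_of_same_carrier hx hpK (fun z => ?_) hint
    by_cases hz : z ∈ ρ
    · have h1 : T.bary K z x ≠ 0 := (Finset.mem_filter.1 hz).2
      have h2 : 0 < T.bary K z x := lt_of_le_of_ne (hxn z) h1.symm
      have h3 : 0 < T.bary K z p := by
        rw [hpb]
        exact add_pos_of_nonneg_of_pos (mul_nonneg (by linarith [ht.2]) (hy'.1 z))
          (mul_pos ht.1 h2)
      exact ⟨fun h => absurd h h1, fun h => absurd h h3.ne'⟩
    · rw [hpb, hρ0 z hz, hy'.2 z hz]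
      simp
  have hlim : Filter.Tendsto (fun t : ℝ => AffineMap.lineMap y x t) (nhdsWithin 0 (Ioi 0))
      (nhds y) := by
    have hc : Continuous fun t : ℝ => (AffineMap.lineMap y x t : E d) := AffineMap.lineMap_continuous
    have := (hc.tendsto 0).mono_left (nhdsWithin_le_nhds (s := Ioi (0 : ℝ)))
    simpa using this
  refine isClosed_frontier.mem_of_tendsto hlim ?_
  filter_upwards [Ioc_mem_nhdsGT (zero_lt_one' ℝ)] with t ht using key t ht

/-- A facet of a cell is the cell without one vertex. -/
def facetOpp (hd : 2 ≤ d) (K : T.Cell) (z : K.1) : T.Facet :=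
  ⟨K.1.erase z, by
    have hc : (K.1.erase z).card = d - 1 + 1 := by
      rw [Finset.card_erase_of_mem z.2, K.2.2]
      omega
    exact ⟨T.toSimplicialComplex.down_closed K.2.1 (Finset.erase_subset _ _)
      (Finset.card_pos.1 (by omega)), hc⟩⟩

theorem facetOpp_subset (hd : 2 ≤ d) (K : T.Cell) (z : K.1) : (T.facetOpp hd K z).1 ⊆ K.1 :=
  Finset.erase_subset _ _

theorem exists_eq_facetOpp (hd : 2 ≤ d) (K : T.Cell) (F : T.Facet) (hF : F.1 ⊆ K.1) :
    ∃ z : K.1, F = T.facetOpp hd K z := by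
  have h1 : (K.1 \ F.1).card = 1 := by
    rw [Finset.card_sdiff_of_subset hF, K.2.2, F.2.2]
    omega
  obtain ⟨z, hz⟩ := Finset.card_eq_one.1 h1
  have hzK : z ∈ K.1 := (Finset.mem_sdiff.1 (hz ▸ Finset.mem_singleton_self z)).1
  refine ⟨⟨z, hzK⟩, Subtype.ext ?_⟩
  change F.1 = K.1.erase z
  rw [← Finset.sdiff_singleton_eq_erase, ← hz, Finset.sdiff_sdiff_eq_self hF]

theorem facetOpp_injective (hd : 2 ≤ d) (K : T.Cell) : Function.Injective (T.facetOpp hd K) := by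
  intro y z h
  have h' : K.1.erase y = K.1.erase z := congrArg Subtype.val h
  exact Subtype.ext (Finset.erase_injOn K.1 (Finset.mem_coe.2 y.2) (Finset.mem_coe.2 z.2) h')

/-- In a mesh with several cells, every cell has a facet that is not in the boundary. -/
theorem exists_inner_facet (hd : 2 ≤ d) (hΩ : IsMeshDomain Ω) (hT : 1 < Nat.card T.Cell)
    (K : T.Cell) : ∃ z : K.1, ¬ OnBoundary Ω (T.facetOpp hd K z).1 := by
  by_contra! hall
  have hopen : IsOpen Ω := hΩ.regular ▸ isOpen_interior
  -- If all facets of K were in ∂Ω, the open cell U would equal Ω ∩ K and hence be open and closed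
  -- in Ω, so Ω = U by connectedness.
  set U : Set (E d) := {x | ∀ z : K.1, 0 < T.bary K z x} with hU
  have hUopen : IsOpen U := by
    have : U = ⋂ z : K.1, T.bary K z ⁻¹' Ioi 0 := by ext; simp [hU]
    rw [this]
    exact isOpen_iInter_of_finite fun z => isOpen_Ioi.preimage (T.continuous_bary K z)
  have hUK : U ⊆ hull K.1 := fun x hx => (T.mem_hull_cell_iff K).2 fun z => by
    by_cases hz : z ∈ K.1
    · exact (hx ⟨z, hz⟩).le
    · rw [T.bary_of_notMem K hz]
  have hΩK : Ω ∩ hull K.1 ⊆ U := by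
    rintro x ⟨hxΩ, hxK⟩ z
    have hxn := (T.mem_hull_cell_iff K).1 hxK
    refine lt_of_le_of_ne (hxn z) fun h0 => ?_
    have hxF : x ∈ hull (T.facetOpp hd K z).1 := by
      refine (T.mem_hull_iff K (T.facetOpp_subset hd K z)).2 ⟨hxn, fun y hy => ?_⟩
      by_cases hyK : y ∈ K.1
      · have : y = z := by
          by_contra hne
          exact hy (Finset.mem_erase.2 ⟨hne, hyK⟩)
        rw [this, ← h0]
      · exact T.bary_of_notMem K hyK x
    have := (hall z hxF).2
    rw [hopen.interior_eq] at this
    exact this hxΩ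
  have hU_Ω : U ⊆ Ω := by
    rw [← hΩ.regular]
    exact interior_maximal (hUK.trans (T.hull_subset_closure K)) hUopen
  have hUne : U.Nonempty := by
    have hw : ∑ _z ∈ K.1, (1 / (d + 1) : ℝ) = 1 := by
      rw [Finset.sum_const, K.2.2, nsmul_eq_mul]
      push_cast
      field_simp
    refine ⟨∑ z ∈ K.1, (1 / (d + 1) : ℝ) • z, fun z => ?_⟩
    rw [T.bary_sum_smul K Finset.Subset.rfl (fun _ => (1 / (d + 1) : ℝ)) hw, if_pos z.2]
    positivity
  have hsub : Ω ⊆ U := by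
    have hcover : Ω ⊆ U ∪ (hull K.1)ᶜ := fun x hx => by
      by_cases hxK : x ∈ hull K.1
      · exact Or.inl (hΩK ⟨hx, hxK⟩)
      · exact Or.inr hxK
    by_contra hns
    obtain ⟨x, hx, hxU⟩ := not_subset.1 hns
    obtain ⟨u, hu⟩ := hUne
    obtain ⟨p, -, hp1, hp2⟩ := hΩ.connected.isPreconnected U (hull K.1)ᶜ hUopen
      (isCompact_hull K.1).isClosed.isOpen_compl hcover ⟨u, hU_Ω hu, hu⟩
      ⟨x, hx, (hcover hx).resolve_left hxU⟩
    exact hp2 (hUK hp1)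
  have hcl : closure Ω ⊆ hull K.1 :=
    closure_minimal (hsub.trans hUK) (isCompact_hull K.1).isClosed
  have : Nontrivial T.Cell := Finite.one_lt_card_iff_nontrivial.1 hT
  obtain ⟨K', hK'⟩ := exists_ne K
  have hns : ¬ K'.1 ⊆ K.1 := fun h =>
    hK' (Subtype.ext (Finset.eq_of_subset_of_card_le h (by rw [K.2.2, K'.2.2])))
  -- A vertex of another cell outside K would lie in closure Ω ⊆ K; its own coordinate would be both
  -- 1 and 0.
  obtain ⟨v, hv, hvK⟩ := Finset.not_subset.1 hns
  have hvK' := mem_hull_of_mem hv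
  have hb := T.bary_eq_of_mem hvK' (hcl (T.hull_subset_closure K' hvK')) v
  rw [T.bary_vertex K' hv, if_pos rfl, T.bary_of_notMem K hvK] at hb
  exact one_ne_zero hb

end Mesh

/-! ### Values and continuity of the Jacobi polynomials. -/

theorem jacobi_zero_neg_one (b n : ℕ) : jacobi 0 b n (-1) = (-1) ^ n * ((n + b).choose n : ℝ) := by
  unfold jacobi
  rw [Finset.sum_eq_single_of_mem n (by simp)]
  · norm_num [mul_comm]
  · intro s hs hsn
    have : n - s ≠ 0 := by
      have := Finset.mem_range.1 hs
      omega
    simp [this]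

theorem jacobi_zero_one (b n : ℕ) : jacobi 0 b n 1 = 1 := by
  rw [jacobi_one]
  simp

theorem continuous_jacobi (a b n : ℕ) : Continuous (jacobi a b n) := by
  unfold jacobi
  fun_prop

theorem continuous_orthoBary {ℓ : ℕ} (α : Fin ℓ → ℕ) : Continuous (orthoBary α) := by
  unfold orthoBary jacobiHom
  fun_prop

namespace Mesh

variable {d : ℕ} {Ω : Set (E d)} (T : Mesh Ω) (A : T.Numbering) {k : ℕ}

instance finite_confIndex : Finite (T.ConfIndex k) := by
  -- The degree bound makes the dimension and all entries of α smaller than k.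
  let f : T.ConfIndex k → Σ n : Fin k, T.Face n × (Fin n → Fin k) := fun i =>
    ⟨⟨i.dim, by have := i.degree_le; omega⟩, i.face, fun j => ⟨i.α j, by
      have h1 := i.degree_le
      have h2 := Finset.single_le_sum (f := i.α) (fun _ _ => Nat.zero_le _) (Finset.mem_univ j)
      omega⟩⟩
  refine Finite.of_injective f ?_
  rintro ⟨n, τ, α, h1, h2⟩ ⟨n', τ', α', h1', h2'⟩ h
  simp only [f, Sigma.mk.injEq, Fin.mk.injEq] at h
  obtain ⟨rfl, h⟩ := h
  simp only [heq_eq_eq, Prod.mk.injEq] at h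
  obtain ⟨rfl, h⟩ := h
  have : α = α' := funext fun j => by simpa using congrFun h j
  subst this
  rfl

instance fintypeConfIndex : Fintype (T.ConfIndex k) := Fintype.ofFinite _

instance fintypeFace (ℓ : ℕ) : Fintype (T.Face ℓ) := Fintype.ofFinite _

/-! ### The conforming basis functions -/

theorem confBasis_eq_zero (i : T.ConfIndex k) {K : T.Cell} {x : E d} {z : E d}
    (hz : z ∈ i.face.1) (h : T.bary K z x = 0) : T.confBasis A i K x = 0 := by
  unfold confBasis bubble
  rw [Finset.prod_eq_zero hz h, zero_mul]

/-- The bubble contains the hat function of a vertex of τ outside σ, which vanishes on σ. -/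
theorem confBasis_eq_zero_of_not_subset (i : T.ConfIndex k) {K : T.Cell} {σ : Finset (E d)}
    (hσ : σ ⊆ K.1) (h : ¬ i.face.1 ⊆ σ) {x : E d} (hx : x ∈ hull σ) :
    T.confBasis A i K x = 0 := by
  obtain ⟨z, hz, hzσ⟩ := Finset.not_subset.1 h
  exact T.confBasis_eq_zero A i hz (((T.mem_hull_iff K hσ).1 hx).2 z hzσ)

theorem confBasis_eq_zero_of_not_subset_cell (i : T.ConfIndex k) {K : T.Cell}
    (h : ¬ i.face.1 ⊆ K.1) (x : E d) : T.confBasis A i K x = 0 := by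
  obtain ⟨z, hz, hzK⟩ := Finset.not_subset.1 h
  exact T.confBasis_eq_zero A i hz (T.bary_of_notMem K hzK x)

theorem confBasis_vertex (i : T.ConfIndex k) {K : T.Cell} {y : E d} (hy : y ∈ K.1) :
    T.confBasis A i K y = 0 := by
  have hc : 1 < i.face.1.card := by
    rw [i.face.2.2]
    have := i.one_le_dim
    omega
  obtain ⟨z, hz, hzy⟩ := Finset.exists_mem_ne hc y
  exact T.confBasis_eq_zero A i hz (by rw [T.bary_vertex K hy, if_neg hzy])

theorem continuous_confBasis (i : T.ConfIndex k) (K : T.Cell) :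
    Continuous (T.confBasis A i K) := by
  unfold confBasis bubble hat
  refine Continuous.mul (continuous_finsetProd _ fun z _ => T.continuous_bary K z) ?_
  exact (continuous_orthoBary i.α).comp (continuous_pi fun j => T.continuous_bary K _)

/-- The functions `B_{τ,α}`, `τ ⊆ σ`, are linearly independent on the face `σ`. -/
theorem confBasis_independent_on_face {K : T.Cell} {σ : Finset (E d)} (hσ : σ ⊆ K.1)
    (c : T.ConfIndex k → ℝ) (hc : ∀ i, ¬ i.face.1 ⊆ σ → c i = 0)
    (h : ∀ x ∈ hull σ, ∑ i, c i * T.confBasis A i K x = 0) : ∀ i, c i = 0 := by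
  -- Induction on the size of the face τ. On τ, functions of faces not contained in τ vanish and
  -- those of proper subfaces have zero coefficients by induction, so only the multiples of W_τ
  -- remain.
  suffices H : ∀ n, ∀ i : T.ConfIndex k, i.face.1.card = n → c i = 0 from fun i => H _ i rfl
  intro n
  induction n using Nat.strong_induction_on with
  | _ n ih =>
  intro i hi
  by_cases hiσ : i.face.1 ⊆ σ
  swap
  · exact hc i hiσ
  set s : Finset (T.ConfIndex k) := Finset.univ.filter fun j => j.face.1 = i.face.1 with hs
  -- `f` and `e` identify the indices on the face of `i` with multi-indices. Their default values,
  -- `0` and `i`, are not taken at the indices in `s` and at their images.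
  let f : T.ConfIndex k → (Fin i.dim → ℕ) := fun j n =>
    if h : i.dim = j.dim then j.α (Fin.cast h n) else 0
  let e : (Fin i.dim → ℕ) → T.ConfIndex k := fun α =>
    if h : (∑ j, α j) + (i.dim + 1) ≤ k then ⟨i.dim, i.face, α, i.one_le_dim, h⟩ else i
  have hef : ∀ j ∈ s, e (f j) = j := by
    rintro ⟨n', ⟨τ, hτ⟩, α, h1, h2⟩ hj
    have hτ' : τ = i.face.1 := by simpa [hs] using hj
    have hn : i.dim = n' := by
      have h3 := hτ.2
      have h4 := i.face.2.2
      rw [hτ'] at h3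
      omega
    obtain ⟨m, ⟨τ', hτ'2⟩, α', h1', h2'⟩ := i
    subst hn
    have hτ' : τ = τ' := hτ'
    subst hτ'
    have hfa : f ⟨m, ⟨τ, hτ⟩, α, h1, h2⟩ = α := by
      funext q
      simp [f]
    rw [hfa]
    exact dif_pos h2
  have key : ∀ α ∈ s.image f, c (e α) = 0 := by
    refine orthoBary_independent (s.image f) (fun α => c (e α)) fun y hy0 hy1 => ?_
    set τ := i.face with hτ
    have hτK : τ.1 ⊆ K.1 := hiσ.trans hσ
    -- The vector y is realized as the barycentric coordinates of a point in the relative interior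
    -- of τ, where the bubble is positive.
    let w : E d → ℝ := fun z => if h : z ∈ τ.1 then y ((A i.dim τ).symm ⟨z, h⟩) else 0
    have hw : ∑ z ∈ τ.1, w z = 1 := by
      rw [← hy1, ← Finset.sum_coe_sort, ← Equiv.sum_comp (A i.dim τ)]
      exact Finset.sum_congr rfl fun j _ => by simp [w]
    set x : E d := ∑ z ∈ τ.1, w z • z with hx
    have hb : ∀ z, T.bary K z x = if z ∈ τ.1 then w z else 0 := T.bary_sum_smul K hτK w hw
    have hwp : ∀ z ∈ τ.1, 0 < w z := fun z hz => by
      simp only [w, dif_pos hz]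
      exact hy0 _
    have hyA : ∀ j, T.bary K (A i.dim τ j) x = y j := fun j => by
      rw [hb, if_pos (A i.dim τ j).2]
      simp [w]
    have hxτ : x ∈ hull τ.1 := (T.mem_hull_iff K hτK).2 ⟨fun z => by
      rw [hb]
      split_ifs with hz
      exacts [(hwp z hz).le, le_rfl], fun z hz => by rw [hb, if_neg hz]⟩
    have hsum := h x (hull_mono hiσ hxτ)
    have hsub : ∑ j ∈ s, c j * T.confBasis A j K x = 0 := by
      rw [← hsum]
      refine Finset.sum_subset (Finset.subset_univ _) fun j _ hj => ?_
      have hne : j.face.1 ≠ τ.1 := fun h => hj (by simp [hs, h])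
      by_cases hjτ : j.face.1 ⊆ τ.1
      · rw [ih _ (hi ▸ Finset.card_lt_card (hjτ.ssubset_of_ne hne)) j rfl, zero_mul]
      · rw [T.confBasis_eq_zero_of_not_subset A j hτK hjτ hxτ, mul_zero]
    have hinj : Set.InjOn f s := fun j hj j' hj' hjj => by
      rw [← hef j hj, ← hef j' hj', hjj]
    have hW : T.bubble τ.1 K x ≠ 0 := by
      refine (Finset.prod_pos fun z hz => ?_).ne'
      change 0 < T.bary K z x
      rw [hb, if_pos hz]
      exact hwp z hz
    refine (mul_eq_zero.1 (?_ : T.bubble τ.1 K x * _ = 0)).resolve_left hW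
    rw [← hsub, Finset.sum_image hinj, Finset.mul_sum]
    refine Finset.sum_congr rfl fun j hj => ?_
    rw [hef j hj]
    have hval : T.confBasis A j K x = T.bubble τ.1 K x * orthoBary (f j) y := by
      conv_lhs => rw [← hef j hj]
      simp only [e]
      split_ifs with hdeg
      · change T.bubble τ.1 K x * orthoBary (f j) (fun q => T.bary K (A i.dim τ q) x) = _
        simp only [hyA]
      · exfalso
        apply hdeg
        obtain ⟨n', ⟨τ', hτ'⟩, α, h1, h2⟩ := j
        have hτ'' : τ' = τ.1 := by simpa [hs] using hj
        have hn : i.dim = n' := by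
          have h3 := hτ'.2
          have h4 := τ.2.2
          rw [hτ''] at h3
          omega
        subst hn
        simpa [f] using h2
    rw [hval]
    ring
  have := key (f i) (Finset.mem_image_of_mem f (by simp [hs]))
  rwa [hef i (by simp [hs])] at this

/-! ### The non-conforming facet functions -/

theorem oppBary_facetOpp (hd : 2 ≤ d) (K : T.Cell) (z : K.1) (x : E d) :
    T.oppBary K (T.facetOpp hd K z) x = T.bary K z x := by
  have : K.1 \ (T.facetOpp hd K z).1 = {(z : E d)} := by
    change K.1 \ K.1.erase z = _
    rw [← Finset.sdiff_singleton_eq_erase, Finset.sdiff_sdiff_eq_self (by simp)]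
  rw [oppBary, this, Finset.sum_singleton]

theorem crFacet_facetOpp (hd : 2 ≤ d) (K : T.Cell) (z : K.1) (x : E d) :
    T.crFacet k (T.facetOpp hd K z) K x =
      jacobi 0 (d - 2) k (1 - 2 * T.bary K z x) - T.cellPoly k K x := by
  rw [crFacet, if_pos (T.facetOpp_subset hd K z), T.oppBary_facetOpp]

theorem crFacet_eq_zero {F : T.Facet} {K : T.Cell} (h : ¬ F.1 ⊆ K.1) (x : E d) :
    T.crFacet k F K x = 0 := if_neg h

theorem continuous_cellPoly (K : T.Cell) : Continuous (T.cellPoly k K) := by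
  unfold cellPoly
  refine continuous_const.mul (continuous_const.add (continuous_finsetSum _ fun z _ => ?_))
  exact (continuous_jacobi _ _ _).comp
    (continuous_const.sub (continuous_const.mul (T.continuous_bary K z)))

theorem continuous_crFacet (F : T.Facet) (K : T.Cell) : Continuous (T.crFacet k F K) := by
  unfold crFacet oppBary
  split_ifs
  · refine Continuous.sub ((continuous_jacobi _ _ _).comp (continuous_const.sub
      (continuous_const.mul (continuous_finsetSum _ fun z _ => T.continuous_bary K z))))
      (T.continuous_cellPoly K)
  · exact continuous_const

/-- Sums over the facets of a cell as sums over its vertices. -/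
theorem sum_facet_eq (hd : 2 ≤ d) (K : T.Cell) (g : T.Facet → ℝ)
    (hg : ∀ F : T.Facet, ¬ F.1 ⊆ K.1 → g F = 0) :
    ∑ F, g F = ∑ z : K.1, g (T.facetOpp hd K z) := by
  rw [← Finset.sum_filter_add_sum_filter_not Finset.univ (fun F : T.Facet => F.1 ⊆ K.1),
    Finset.sum_eq_zero (s := Finset.univ.filter fun F : T.Facet => ¬ F.1 ⊆ K.1)
      (fun F hF => hg F (Finset.mem_filter.1 hF).2), add_zero]
  symm
  refine Finset.sum_bij (fun z _ => T.facetOpp hd K z) (fun z _ => ?_)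
    (fun y _ z _ h => T.facetOpp_injective hd K h) (fun F hF => ?_) fun z _ => rfl
  · simpa using T.facetOpp_subset hd K z
  · obtain ⟨z, hz⟩ := T.exists_eq_facetOpp hd K F (Finset.mem_filter.1 hF).2
    exact ⟨z, Finset.mem_univ _, hz.symm⟩

/-- The functions of the facets of a cell at a vertex `z` add up to `1 - P_k^{(0,d-2)}(1 - 2 λ_z)`. -/
theorem sum_crFacet (hd : 2 ≤ d) (K : T.Cell) (z : K.1) (x : E d) :
    ∑ y ∈ Finset.univ.erase z, T.crFacet k (T.facetOpp hd K y) K x =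
      1 - jacobi 0 (d - 2) k (1 - 2 * T.bary K z x) := by
  have hd0 : (d : ℝ) ≠ 0 := by positivity
  -- By the definition of `cellPoly`; the multiple d `cellPoly` cancels against the d facets through
  -- z.
  have h1 : ∑ y : K.1, jacobi 0 (d - 2) k (1 - 2 * T.bary K y x) =
      d * T.cellPoly k K x + 1 := by
    rw [Finset.sum_coe_sort K.1 (fun y => jacobi 0 (d - 2) k (1 - 2 * T.bary K y x)), cellPoly]
    field_simp
    ring
  simp only [T.crFacet_facetOpp, Finset.sum_sub_distrib, Finset.sum_const]
  rw [Finset.card_erase_of_mem (Finset.mem_univ _), Finset.card_univ, Fintype.card_coe, K.2.2,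
    Finset.sum_erase_eq_sub (Finset.mem_univ _), h1]
  simp
  ring

/-- The constant `-P_k^{(0,d-2)}(-1)` for odd `k`. -/
theorem jacobi_neg_one_of_odd (hk : Odd k) (b : ℕ) :
    jacobi 0 b k (-1) = -((k + b).choose k : ℝ) := by
  rw [jacobi_zero_neg_one, hk.neg_one_pow]
  ring

theorem jacobi_vertex (hk : Odd k) {K : T.Cell} {y : E d} (hy : y ∈ K.1) (b : ℕ) (z : E d) :
    jacobi 0 b k (1 - 2 * T.bary K z y) =
      1 - (1 + ((k + b).choose k : ℝ)) * if z = y then 1 else 0 := by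
  rw [T.bary_vertex K hy]
  split_ifs with h
  · rw [show (1 : ℝ) - 2 * 1 = -1 by norm_num, jacobi_neg_one_of_odd hk]
    ring
  · rw [mul_zero, sub_zero, jacobi_zero_one]
    ring

/-- Among the d+1 Jacobi terms of `cellPoly`, all but the one for y itself are 1 at y. Oddness of k
makes the common factor 1 + binom(k+d-2, k) nonzero. -/
theorem crFacet_vertex (hd : 2 ≤ d) (hk : Odd k) (K : T.Cell) (y z : K.1) :
    T.crFacet k (T.facetOpp hd K z) K y =
      (1 + ((k + (d - 2)).choose k : ℝ)) * (1 / d - if z = y then 1 else 0) := by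
  have hd0 : (d : ℝ) ≠ 0 := by positivity
  have h1 : ∑ z ∈ K.1, jacobi 0 (d - 2) k (1 - 2 * T.bary K z y) =
      d - ((k + (d - 2)).choose k : ℝ) := by
    simp only [T.jacobi_vertex hk y.2, Finset.sum_sub_distrib, Finset.sum_const, ← Finset.mul_sum]
    rw [Finset.sum_ite_eq' K.1 (y : E d), if_pos y.2, K.2.2]
    simp
    ring
  rw [T.crFacet_facetOpp, T.jacobi_vertex hk y.2, cellPoly, h1]
  simp only [Subtype.ext_iff]
  field_simp
  ring

/-- Local linear independence on a cell, and on a facet of it if one of the other facets is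
disregarded. -/
theorem local_independent (hd : 2 ≤ d) (hk : Odd k) {K : T.Cell} {σ : Finset (E d)}
    (hσK : σ ⊆ K.1) (c : T.ConfIndex k → ℝ) (e : K.1 → ℝ)
    (hσ : σ = K.1 ∨ ∃ y z : K.1, z ≠ y ∧ σ = K.1.erase y ∧ e z = 0)
    (hc : ∀ i, ¬ i.face.1 ⊆ σ → c i = 0)
    (h : ∀ x ∈ hull σ, ∑ i, c i * T.confBasis A i K x +
      ∑ z, e z * T.crFacet k (T.facetOpp hd K z) K x = 0) :
    (∀ i, c i = 0) ∧ ∀ z, e z = 0 := by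
  have hd0 : (d : ℝ) ≠ 0 := by positivity
  -- At a vertex the conforming functions vanish, and the relation becomes one row of the matrix
  -- (1/d - δ_{yz}).
  have he : ∀ y : K.1, (y : E d) ∈ σ → e y = (∑ z, e z) / d := by
    intro y hy
    have h1 := h y (mem_hull_of_mem hy)
    rw [Finset.sum_eq_zero fun i _ => by rw [T.confBasis_vertex A i y.2, mul_zero], zero_add] at h1
    have h2 : ∑ z, e z * T.crFacet k (T.facetOpp hd K z) K y =
        (1 + ((k + (d - 2)).choose k : ℝ)) * ((∑ z, e z) / d - e y) := by
      have h3 : ∀ z, e z * T.crFacet k (T.facetOpp hd K z) K y =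
          (1 + ((k + (d - 2)).choose k : ℝ)) * (e z / d - if z = y then e z else 0) := by
        intro z
        rw [T.crFacet_vertex hd hk]
        split_ifs <;> ring
      rw [Finset.sum_congr rfl fun z _ => h3 z, ← Finset.mul_sum, Finset.sum_sub_distrib,
        Finset.sum_ite_eq' Finset.univ y, if_pos (Finset.mem_univ _), Finset.sum_div]
    rw [h2] at h1
    have h4 : (1 + ((k + (d - 2)).choose k : ℝ)) ≠ 0 := by positivity
    linarith [(mul_eq_zero.1 h1).resolve_left h4]
  have hS : ∀ z, e z = 0 := by
    rcases hσ with rfl | ⟨y, z, hzy, rfl, hez⟩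
    -- All d+1 rows are available, so the sum S of the coefficients satisfies S = (d+1) S/d.
    · have h1 : ∑ z, e z = (d + 1) * ((∑ z, e z) / d) := by
        conv_lhs => rw [Finset.sum_congr rfl fun z _ => he z z.2]
        rw [Finset.sum_const, Finset.card_univ, Fintype.card_coe, K.2.2]
        simp
      have h2 : ∑ z, e z = 0 := by
        field_simp at h1
        linarith
      intro z
      rw [he z z.2, h2, zero_div]
    · have hmem : ∀ x : K.1, x ≠ y → (x : E d) ∈ K.1.erase y := fun x hx =>
        Finset.mem_erase.2 ⟨fun hh => hx (Subtype.ext hh), x.2⟩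
      -- The row of y is missing. The coefficients other than that of y all equal S/d, and the
      -- disregarded z shows that this is 0.
      have h1 : ∑ z, e z = 0 := by
        have h1 := he z (hmem z hzy)
        rw [hez] at h1
        field_simp at h1
        linarith
      have h2 : ∀ x : K.1, x ≠ y → e x = 0 := fun x hx => by rw [he x (hmem x hx), h1, zero_div]
      intro x
      by_cases hx : x = y
      · rw [hx, ← h1, Finset.sum_eq_single y (fun z _ hz => h2 z hz) (by simp)]
      · exact h2 x hx
  refine ⟨T.confBasis_independent_on_face A hσK c hc fun x hx => ?_, hS⟩
  rw [← h x hx, Finset.sum_eq_zero (s := Finset.univ) (f := fun z => e z * _)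
    fun z _ => by rw [hS z, zero_mul], add_zero]

/-! ### Global linear independence. -/

/-- A relation can be tested cell by cell: on K only the functions with τ ⊆ K or F ⊆ K survive, and
each index occurs on some cell. -/
theorem linearIndependent_crBasis (hd : 2 ≤ d) (hk : Odd k) :
    LinearIndependent ℝ (T.crBasis A k) := by
  rw [Fintype.linearIndependent_iff]
  intro g hg
  have hloc : ∀ K : T.Cell, (∀ i : T.ConfIndex k, i.face.1 ⊆ K.1 → g (Sum.inl i) = 0) ∧
      ∀ z, g (Sum.inr (T.facetOpp hd K z)) = 0 := by
    intro K
    have := T.local_independent A hd hk (Finset.Subset.refl K.1)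
      (fun i => if i.face.1 ⊆ K.1 then g (Sum.inl i) else 0)
      (fun z => g (Sum.inr (T.facetOpp hd K z))) (Or.inl rfl) (fun i hi => if_neg hi) fun x _ => by
        have h1 := congrFun (congrFun hg K) x
        rw [Fintype.sum_sum_type] at h1
        simp only [crBasis, Sum.elim_inl, Sum.elim_inr, Pi.add_apply, Finset.sum_apply,
          Pi.smul_apply, smul_eq_mul, Pi.zero_apply] at h1
        rw [← h1, T.sum_facet_eq hd K (fun F => g (Sum.inr F) * T.crFacet k F K x)
          fun F hF => by rw [T.crFacet_eq_zero hF, mul_zero]]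
        congr 1
        refine Finset.sum_congr rfl fun i _ => ?_
        split_ifs with hi
        · rfl
        · rw [T.confBasis_eq_zero_of_not_subset_cell A i hi, mul_zero, mul_zero]
    exact ⟨fun i hi => by simpa [hi] using this.1 i, this.2⟩
  rintro (i | F)
  · obtain ⟨K, hK⟩ := T.exists_cell i.face.2.1
    exact (hloc K).1 i hK
  · obtain ⟨K, hK⟩ := T.exists_cell F.2.1
    obtain ⟨z, rfl⟩ := T.exists_eq_facetOpp hd K F hK
    exact (hloc K).2 z

theorem ZeroIndex.toFull_injective :
    Function.Injective (ZeroIndex.toFull : T.ZeroIndex k → T.FullIndex k) :=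
  Sum.map_injective.2 ⟨Subtype.val_injective, Subtype.val_injective⟩

theorem linearIndependent_crBasis0 (hd : 2 ≤ d) (hk : Odd k) :
    LinearIndependent ℝ (T.crBasis0 A k) :=
  (T.linearIndependent_crBasis A hd hk).comp _ (ZeroIndex.toFull_injective T)

end Mesh

/-! ### Homogeneous polynomials on simplices, and a dimension count. -/

section Homogeneous

open MvPolynomial

theorem eval_const_mul_of_isHomogeneous {σ : Type*} {p : MvPolynomial σ ℝ} {k : ℕ}
    (hp : p.IsHomogeneous k) (c : ℝ) (w : σ → ℝ) :
    eval (fun i => c * w i) p = c ^ k * eval w p := by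
  rw [eval_eq, eval_eq, Finset.mul_sum]
  refine Finset.sum_congr rfl fun β hβ => ?_
  have hdeg : ∑ i ∈ β.support, β i = k := by
    have := hp (mem_support_iff.1 hβ)
    rwa [Finsupp.weight_apply, Finsupp.sum, Finset.sum_congr rfl fun i _ => by
      rw [Pi.one_apply, smul_eq_mul, mul_one]] at this
  simp only [mul_pow]
  rw [Finset.prod_mul_distrib, Finset.prod_pow_eq_pow_sum, hdeg]
  ring

theorem prod_pow_eq_zero {σ : Type*} {β : σ →₀ ℕ} {s : Finset σ} (h : ¬ β.support ⊆ s)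
    {w : σ → ℝ} (hw : ∀ z, z ∉ s → w z = 0) : ∏ i ∈ β.support, w i ^ β i = 0 := by
  obtain ⟨z, hz, hzs⟩ := Finset.not_subset.1 h
  refine Finset.prod_eq_zero hz ?_
  rw [hw z hzs, zero_pow (Finsupp.mem_support_iff.1 hz)]

/-- A homogeneous polynomial that vanishes on a simplex has no monomials in the barycentric
coordinates of this simplex. -/
theorem coeff_eq_zero_of_vanish {σ : Type*} {p : MvPolynomial σ ℝ} {k : ℕ}
    (hp : p.IsHomogeneous k) {s : Finset σ} (hs : s.Nonempty)
    (h : ∀ w : σ → ℝ, (∀ z, 0 ≤ w z) → (∀ z, z ∉ s → w z = 0) → ∑ z ∈ s, w z = 1 →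
      eval w p = 0) {β : σ →₀ ℕ} (hβ : β.support ⊆ s) : coeff β p = 0 := by
  -- The part of p in the variables of s. On the positive orthant it equals p after the other
  -- variables are set to 0, and homogeneity rescales that point to the simplex.
  set q : MvPolynomial σ ℝ := ∑ γ ∈ p.support.filter fun γ => γ.support ⊆ s,
    monomial γ (coeff γ p) with hq
  have hq0 : q = 0 := by
    refine funext_set (fun _ => Ioi (0 : ℝ)) (fun _ => Ioi_infinite 0) fun w hw => ?_
    have hw0 : ∀ z, 0 < w z := fun z => hw z (mem_univ z)
    set w' : σ → ℝ := fun z => if z ∈ s then w z else 0 with hw'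
    have hS : 0 < ∑ z ∈ s, w z := Finset.sum_pos (fun z _ => hw0 z) hs
    have h1 : eval w q = eval w' p := by
      rw [hq, map_sum, eval_eq w', Finset.sum_filter]
      refine Finset.sum_congr rfl fun γ _ => ?_
      split_ifs with hγ
      · rw [eval_monomial, Finsupp.prod]
        congr 1
        refine Finset.prod_congr rfl fun z hz => ?_
        rw [hw']
        simp only [if_pos (hγ hz)]
      · rw [prod_pow_eq_zero hγ fun z hz => by rw [hw']; exact if_neg hz, mul_zero]
    have h2 : eval (fun z => (∑ z ∈ s, w z)⁻¹ * w' z) p = 0 := by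
      refine h _ (fun z => ?_) (fun z hz => ?_) ?_
      · refine mul_nonneg (inv_nonneg.2 hS.le) ?_
        simp only [hw']
        split_ifs
        exacts [(hw0 z).le, le_rfl]
      · simp only [hw', if_neg hz, mul_zero]
      · have h3 : ∑ z ∈ s, w' z = ∑ z ∈ s, w z := Finset.sum_congr rfl fun z hz => if_pos hz
        rw [← Finset.mul_sum, h3, inv_mul_cancel₀ hS.ne']
    rw [eval_const_mul_of_isHomogeneous hp] at h2
    rw [h1, map_zero]
    exact (mul_eq_zero.1 h2).resolve_left (pow_ne_zero _ (inv_ne_zero hS.ne'))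
  by_cases hβp : β ∈ p.support
  · have := congrArg (coeff β) hq0
    rw [hq, coeff_sum, coeff_zero, Finset.sum_eq_single β] at this
    · simpa using this
    · intro γ _ hγ
      rw [coeff_monomial, if_neg hγ]
    · intro hn
      exact absurd (Finset.mem_filter.2 ⟨hβp, hβ⟩) hn
  · exact notMem_support_iff.1 hβp

theorem totalDegree_aeval_le {σ τ : Type*} (p : MvPolynomial σ ℝ) (f : σ → MvPolynomial τ ℝ)
    (hf : ∀ i, (f i).totalDegree ≤ 1) : (aeval f p).totalDegree ≤ p.totalDegree := by
  rw [aeval_def, eval₂_eq]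
  refine totalDegree_finsetSum_le fun β hβ => (totalDegree_mul _ _).trans ?_
  rw [algebraMap_eq, totalDegree_C, zero_add]
  refine (totalDegree_finsetProd _ _).trans (le_trans ?_ (le_totalDegree hβ))
  refine Finset.sum_le_sum fun i _ => (totalDegree_pow _ _).trans ?_
  calc β i * (f i).totalDegree ≤ β i * 1 := Nat.mul_le_mul_left _ (hf i)
    _ = β i := mul_one _

end Homogeneous

/-- This exchanges Bernstein functions for the B_{τ,α} by counting alone, without a formula for the
change of basis. -/
theorem span_le_span_of_card_le {ι κ X : Type*} [AddCommGroup X] [Module ℝ X] [Fintype ι]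
    [Fintype κ] {v : ι → X} {w : κ → X} (hv : LinearIndependent ℝ v)
    (hvw : ∀ i, v i ∈ Submodule.span ℝ (range w)) (hcard : Fintype.card κ ≤ Fintype.card ι) :
    Submodule.span ℝ (range w) ≤ Submodule.span ℝ (range v) := by
  have hle : Submodule.span ℝ (range v) ≤ Submodule.span ℝ (range w) :=
    Submodule.span_le.2 (range_subset_iff.2 hvw)
  have : FiniteDimensional ℝ (Submodule.span ℝ (range w)) :=
    FiniteDimensional.span_of_finite ℝ (finite_range w)
  refine (Submodule.eq_of_le_of_finrank_le hle ?_).ge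
  rw [finrank_span_eq_card hv]
  exact (finrank_range_le_card w).trans hcard

namespace Mesh

open MvPolynomial

variable {d : ℕ} {Ω : Set (E d)} (T : Mesh Ω) (A : T.Numbering) {k : ℕ}

/-! ### Polynomials in the hat functions -/

/-- Points of ℝ^d serve as names of variables; evaluation at x on K is an algebra homomorphism. -/
theorem aeval_hat_apply (p : MvPolynomial (E d) ℝ) (K : T.Cell) (x : E d) :
    (aeval T.hat p : T.Broken) K x = eval (fun z => T.bary K z x) p := by
  let ev : T.Broken →ₐ[ℝ] ℝ := (Pi.evalAlgHom ℝ (fun _ : E d => ℝ) x).comp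
    (Pi.evalAlgHom ℝ (fun _ : T.Cell => E d → ℝ) K)
  change ev (aeval T.hat p) = _
  rw [← MvPolynomial.aeval_eq_eval, ← AlgHom.comp_apply, comp_aeval]
  rfl

theorem exists_poly_bary (K : T.Cell) (z : E d) : ∃ P : MvPolynomial (Fin d) ℝ,
    P.totalDegree ≤ 1 ∧ ∀ x : E d, T.bary K z x = eval (fun i => x i) P := by
  by_cases hz : z ∈ K.1
  · set g := (T.cellBasis K).coord ⟨z, hz⟩
    refine ⟨C (g 0) + ∑ i, C (g.linear (EuclideanSpace.basisFun (Fin d) ℝ i)) * X i, ?_,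
      fun x => ?_⟩
    · refine (totalDegree_add _ _).trans (max_le (by simp) ?_)
      refine totalDegree_finsetSum_le fun i _ => (totalDegree_mul _ _).trans ?_
      rw [totalDegree_C, totalDegree_X]
    · rw [T.bary_of_mem K hz]
      have h1 : g x = g.linear x + g 0 := by
        have := g.map_vadd 0 x
        simpa using this
      have h2 : g.linear x = ∑ i, x i * g.linear (EuclideanSpace.basisFun (Fin d) ℝ i) := by
        conv_lhs => rw [← (EuclideanSpace.basisFun (Fin d) ℝ).sum_repr x]
        simp [map_sum]
      change g x = _
      rw [h1, h2]
      simp only [map_add, map_sum, map_mul, eval_C, eval_X]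
      rw [add_comm]
      congr 1
      exact Finset.sum_congr rfl fun i _ => mul_comm _ _
  · exact ⟨0, by simp, fun x => by rw [T.bary_of_notMem K hz, map_zero]⟩

theorem aeval_hat_mem_S {p : MvPolynomial (E d) ℝ} (hp : p.totalDegree ≤ k) :
    (aeval T.hat p : T.Broken) ∈ T.S k := by
  have hcont : ∀ K, Continuous ((aeval T.hat p : T.Broken) K) := fun K => by
    have : (aeval T.hat p : T.Broken) K = fun x => eval (fun z => T.bary K z x) p :=
      funext fun x => T.aeval_hat_apply p K x
    rw [this]
    simp only [eval_eq]
    exact continuous_finsetSum _ fun β _ => continuous_const.mul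
      (continuous_finsetProd _ fun z _ => (T.continuous_bary K z).pow _)
  refine ⟨fun K => ?_, ?_⟩
  · choose P hP hPx using T.exists_poly_bary K
    refine ⟨aeval P p, (totalDegree_aeval_le p P hP).trans hp, fun x => ?_⟩
    rw [T.aeval_hat_apply, ← MvPolynomial.aeval_eq_eval, ← MvPolynomial.aeval_eq_eval,
      ← AlgHom.comp_apply, comp_aeval]
    congr 2
    funext z
    exact hPx z x
  -- Any cell containing x gives the same value, and continuity glues over the finitely many closed
  -- cells.
  · let v : E d → ℝ := fun x => if h : ∃ K : T.Cell, x ∈ hull K.1 then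
      (aeval T.hat p : T.Broken) h.choose x else 0
    have hv : ∀ K : T.Cell, ∀ x ∈ hull K.1, (aeval T.hat p : T.Broken) K x = v x := by
      intro K x hx
      have h : ∃ K : T.Cell, x ∈ hull K.1 := ⟨K, hx⟩
      simp only [v, dif_pos h, T.aeval_hat_apply]
      congr 2
      funext z
      exact T.bary_eq_of_mem hx h.choose_spec z
    refine ⟨v, ?_, hv⟩
    rw [T.closure_eq_iUnion_cell]
    refine (locallyFinite_of_finite _).continuousOn_iUnion
      (fun K => (isCompact_hull K.1).isClosed) fun K => ?_
    exact (hcont K).continuousOn.congr fun x hx => (hv K x hx).symm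

theorem confBasis_eq_aeval_hat (i : T.ConfIndex k) : T.confBasis A i =
    aeval T.hat ((∏ z ∈ i.face.1, X z) *
      orthoBaryAlg i.α fun j => X (A i.dim i.face j : E d) : MvPolynomial (E d) ℝ) := by
  funext K x
  rw [T.aeval_hat_apply, map_mul, map_prod, ← MvPolynomial.aeval_eq_eval]
  rw [map_orthoBaryAlg, orthoBaryAlg_real]
  simp only [confBasis, bubble, hat, Function.comp_def, aeval_X]

theorem confBasis_mem_S (i : T.ConfIndex k) : T.confBasis A i ∈ T.S k := by
  rw [T.confBasis_eq_aeval_hat]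
  refine T.aeval_hat_mem_S ((totalDegree_mul _ _).trans ?_)
  have h1 : (∏ z ∈ i.face.1, X z : MvPolynomial (E d) ℝ).totalDegree ≤ i.dim + 1 := by
    refine (totalDegree_finsetProd _ _).trans ?_
    simp [i.face.2.2]
  have h2 := totalDegree_orthoBaryAlg_le i.α
    (y := fun j => (X (A i.dim i.face j : E d) : MvPolynomial (E d) ℝ)) fun j => by simp
  have := i.degree_le
  omega

/-- The Bernstein representation of a polynomial on a cell. -/
theorem exists_homogeneous (K : T.Cell) {f : E d → ℝ} (hf : IsPoly k f) :
    ∃ p : MvPolynomial (E d) ℝ, p.IsHomogeneous k ∧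
      ∀ x, f x = eval (fun z => T.bary K z x) p := by
  obtain ⟨P, hP, hPx⟩ := hf
  -- In barycentric coordinates, `L i` is the Cartesian coordinate x_i and `s` is the constant 1,
  -- which pads each monomial to degree k.
  let L : Fin d → MvPolynomial (E d) ℝ := fun i => ∑ z ∈ K.1, C (z i) * X z
  let s : MvPolynomial (E d) ℝ := ∑ z ∈ K.1, X z
  have hL : ∀ i, (L i).IsHomogeneous 1 := fun i =>
    IsHomogeneous.sum _ _ _ fun z _ => isHomogeneous_C_mul_X _ _
  have hs : s.IsHomogeneous 1 := IsHomogeneous.sum _ _ _ fun z _ => isHomogeneous_X _ _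
  refine ⟨∑ m ∈ P.support, C (coeff m P) * ((∏ i, L i ^ m i) * s ^ (k - ∑ i, m i)), ?_,
    fun x => ?_⟩
  · refine IsHomogeneous.sum _ _ _ fun m hm => ?_
    have hmk : ∑ i, m i ≤ k := by
      have h1 := (le_totalDegree hm).trans hP
      rwa [Finsupp.sum_fintype _ _ fun _ => rfl] at h1
    have h1 : (∏ i, L i ^ m i).IsHomogeneous (∑ i, 1 * m i) :=
      IsHomogeneous.prod _ _ _ fun i _ => (hL i).pow _
    have h2 := (isHomogeneous_C (E d) (coeff m P)).mul (h1.mul (hs.pow (k - ∑ i, m i)))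
    simp only [one_mul] at h2
    rwa [show 0 + (∑ i, m i + (k - ∑ i, m i)) = k by omega] at h2
  · have hLx : ∀ i, eval (fun z => T.bary K z x) (L i) = x i := fun i => by
      have := congrArg (fun y : E d => y i) (T.sum_bary_smul K x)
      simp only [WithLp.ofLp_sum, Finset.sum_apply, PiLp.smul_apply, smul_eq_mul] at this
      rw [← this]
      simp [L, map_sum, mul_comm]
    have hsx : eval (fun z => T.bary K z x) s = 1 := by
      rw [← T.sum_bary K x]
      simp [s, map_sum]
    rw [hPx, eval_eq', map_sum]
    refine Finset.sum_congr rfl fun m _ => ?_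
    rw [map_mul, map_mul, map_prod, map_pow, hsx, one_pow, mul_one, eval_C]
    simp only [map_pow, hLx]

theorem coeff_eq_zero_of_vanish_hull {K : T.Cell} {p : MvPolynomial (E d) ℝ}
    (hp : p.IsHomogeneous k) {σ : Finset (E d)} (hσ : σ ⊆ K.1) (hne : σ.Nonempty)
    (h : ∀ x ∈ hull σ, eval (fun z => T.bary K z x) p = 0) {β : E d →₀ ℕ}
    (hβ : β.support ⊆ σ) : coeff β p = 0 := by
  refine coeff_eq_zero_of_vanish hp hne (fun w hw0 hwσ hw1 => ?_) hβ
  have hb := T.bary_sum_smul K hσ w hw1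
  have hw : (fun z => T.bary K z (∑ y ∈ σ, w y • y)) = w := funext fun z => by
    rw [hb]
    split_ifs with hz
    exacts [rfl, (hwσ z hz).symm]
  rw [← hw]
  refine h _ ((T.mem_hull_iff K hσ).2 ⟨fun z => ?_, fun z hz => ?_⟩)
  · rw [congrFun hw z]
    exact hw0 z
  · rw [congrFun hw z, hwσ z hz]

/-- The exponents of the Bernstein polynomials for faces of positive dimension with property
`Q`. -/
abbrev BernIndex (k : ℕ) (Q : Finset (E d) → Prop) : Type :=
  {β : E d →₀ ℕ // β.support ∈ T.faces ∧ ∑ z ∈ β.support, β z = k ∧ 2 ≤ β.support.card ∧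
    Q β.support}

/-- Each Bernstein exponent determines an index of a conforming basis function. -/
def bernToConf {Q : Finset (E d) → Prop} (β : T.BernIndex k Q) :
    {i : T.ConfIndex k // Q i.face.1} :=
  ⟨{ dim := β.1.support.card - 1
     face := ⟨β.1.support, β.2.1, by have := β.2.2.2.1; omega⟩
     -- One power of each vertex goes into the bubble; the exponent of A_0 is dropped.
     α := fun j => β.1 (A (β.1.support.card - 1)
      ⟨β.1.support, β.2.1, by have := β.2.2.2.1; omega⟩ j.succ : E d) - 1
     one_le_dim := by have := β.2.2.2.1; omega
     degree_le := by
      have hc : 2 ≤ β.1.support.card := β.2.2.2.1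
      set a := A (β.1.support.card - 1) ⟨β.1.support, β.2.1, by omega⟩
      have hpos : ∀ j, 1 ≤ β.1 (a j : E d) := fun j =>
        Nat.one_le_iff_ne_zero.2 (Finsupp.mem_support_iff.1 (a j).2)
      have h1 : ∑ j, β.1 (a j : E d) = k := by
        conv_rhs => rw [← β.2.2.1]
        rw [Equiv.sum_comp a fun z => β.1 (z : E d)]
        exact Finset.sum_coe_sort β.1.support β.1
      -- The lowered exponents of all ℓ+1 vertices sum to k - (ℓ+1); dropping the one of A_0 leaves
      -- an inequality.
      have h2 : ∑ j, (β.1 (a j : E d) - 1) + ∑ _j : Fin (β.1.support.card - 1 + 1), 1 = k := by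
        rw [← Finset.sum_add_distrib]
        refine Eq.trans ?_ h1
        exact Finset.sum_congr rfl fun j _ => Nat.sub_add_cancel (hpos j)
      rw [Fin.sum_univ_succ] at h2
      simp only [Finset.sum_const, Finset.card_univ, Fintype.card_fin, smul_eq_mul,
        mul_one] at h2
      omega }, β.2.2.2.2⟩

/-- Only the exponent of A_0 is forgotten, and the total degree k restores it. -/
theorem bernToConf_injective (Q : Finset (E d) → Prop) :
    Function.Injective (T.bernToConf A : T.BernIndex k Q → _) := by
  -- The recovered exponents depend on the index alone, so equal indices can be compared without
  -- transport along equal dimensions.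
  let γ : T.ConfIndex k → E d → ℕ := fun i z =>
    ∑ j : Fin i.dim, if (A i.dim i.face j.succ : E d) = z then i.α j + 1 else 0
  have key : ∀ (β : T.BernIndex k Q) (i : T.ConfIndex k), (T.bernToConf A β).1 = i →
      β.1.support = i.face.1 ∧ ∀ z ∈ i.face.1, z ≠ A i.dim i.face 0 → β.1 z = γ i z := by
    rintro β _ rfl
    refine ⟨rfl, fun z hz hz0 => ?_⟩
    set i := (T.bernToConf A β).1 with hi
    obtain ⟨j, hj⟩ := (A i.dim i.face).surjective ⟨z, hz⟩
    have hj0 : j ≠ 0 := fun h => hz0 (by rw [← h, hj])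
    obtain ⟨q, rfl⟩ := Fin.exists_succ_eq_of_ne_zero hj0
    simp only [γ]
    rw [Finset.sum_eq_single q, if_pos (by rw [hj])]
    · have h1 : i.α q = β.1 (A i.dim i.face q.succ : E d) - 1 := rfl
      rw [h1, hj]
      have h2 : β.1 z ≠ 0 := Finsupp.mem_support_iff.1 hz
      exact (Nat.sub_add_cancel (Nat.one_le_iff_ne_zero.2 h2)).symm
    · intro q' _ hq'
      refine if_neg fun h => hq' ?_
      have h' : A i.dim i.face q'.succ = ⟨z, hz⟩ := Subtype.ext h
      exact Fin.succ_injective _ ((A i.dim i.face).injective (h'.trans hj.symm))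
    · simp
  intro β β' h
  obtain ⟨h1, h2⟩ := key β _ rfl
  obtain ⟨h1', h2'⟩ := key β' _ (congrArg Subtype.val h).symm
  set i := (T.bernToConf A β).1
  have hmem : (A i.dim i.face 0 : E d) ∈ i.face.1 := (A i.dim i.face 0).2
  have hne : ∀ z ∈ i.face.1.erase (A i.dim i.face 0), β.1 z = β'.1 z := fun z hz => by
    rw [h2 z (Finset.mem_of_mem_erase hz) (Finset.ne_of_mem_erase hz),
      h2' z (Finset.mem_of_mem_erase hz) (Finset.ne_of_mem_erase hz)]
  refine Subtype.ext (Finsupp.ext fun z => ?_)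
  by_cases hz : z ∈ i.face.1
  · by_cases hz0 : z = A i.dim i.face 0
    · have hs := β.2.2.1.trans β'.2.2.1.symm
      rw [h1, h1', ← Finset.add_sum_erase _ _ hmem, ← Finset.add_sum_erase _ β'.1 hmem,
        Finset.sum_congr rfl hne] at hs
      rw [hz0]
      exact Nat.add_right_cancel hs
    · exact hne z (Finset.mem_erase.2 ⟨hz0, hz⟩)
  · rw [Finsupp.notMem_support_iff.1 (h1 ▸ hz), Finsupp.notMem_support_iff.1 (h1' ▸ hz)]

instance finite_bernIndex (Q : Finset (E d) → Prop) : Finite (T.BernIndex k Q) :=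
  have A : T.Numbering := fun _ τ => (Finset.equivFinOfCardEq τ.2.2).symm
  Finite.of_injective _ (T.bernToConf_injective A Q)

instance fintypeBernIndex (Q : Finset (E d) → Prop) : Fintype (T.BernIndex k Q) :=
  Fintype.ofFinite _

/-- The coefficient of an exponent β is determined by u on the face spanned by the support of β.
Cells sharing this face therefore agree on it by continuity, and it is zero where u vanishes on that
face. -/
theorem mem_span_bernstein (hk : 1 ≤ k) (Q : Finset (E d) → Prop) {u : T.Broken}
    (hu : u ∈ T.S k) (hvert : ∀ K : T.Cell, ∀ z ∈ K.1, u K z = 0)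
    (hQ : ∀ σ ∈ T.faces, ¬ Q σ → ∀ K : T.Cell, ∀ x ∈ hull K.1, x ∈ hull σ → u K x = 0) :
    u ∈ Submodule.span ℝ (range fun β : T.BernIndex k Q =>
      (aeval T.hat (monomial β.1 (1 : ℝ)) : T.Broken)) := by
  obtain ⟨hpoly, v, -, hv⟩ := hu
  choose p hp hpx using fun K => T.exists_homogeneous K (hpoly K)
  let b : T.BernIndex k Q → ℝ := fun β => coeff β.1 (p (T.exists_cell β.2.1).choose)
  have hb : ∀ (β : T.BernIndex k Q) (K : T.Cell), β.1.support ⊆ K.1 →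
      coeff β.1 (p K) = b β := by
    intro β K hK
    set K' := (T.exists_cell β.2.1).choose with hK'
    have hβK' : β.1.support ⊆ K'.1 := (T.exists_cell β.2.1).choose_spec
    rw [← sub_eq_zero, ← coeff_sub]
    refine T.coeff_eq_zero_of_vanish_hull ((hp K).sub (hp K')) hK
      (T.nonempty_of_mem_faces β.2.1) (fun x hx => ?_) Finset.Subset.rfl
    have hxK := hull_mono hK hx
    have hxK' := hull_mono hβK' hx
    rw [map_sub, ← hpx K, funext fun z => T.bary_eq_of_mem hxK hxK' z, ← hpx K', hv K x hxK,
      hv K' x hxK', sub_self]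
  have hzero : ∀ (K : T.Cell) (β : E d →₀ ℕ), β.support ⊆ K.1 → β ∈ (p K).support →
      (¬ ∃ γ : T.BernIndex k Q, γ.1 = β) → coeff β (p K) = 0 := by
    intro K β hβK hβ hn
    have hdeg : ∑ z ∈ β.support, β z = k := by
      have := hp K (mem_support_iff.1 hβ)
      rwa [Finsupp.weight_apply, Finsupp.sum, Finset.sum_congr rfl fun i _ => by
        rw [Pi.one_apply, smul_eq_mul, mul_one]] at this
    -- The empty exponent has degree 0, which is excluded by k ≥ 1.
    have hne : β.support.Nonempty := by
      by_contra h
      rw [Finset.not_nonempty_iff_eq_empty.1 h, Finset.sum_empty] at hdeg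
      omega
    have hface : β.support ∈ T.faces :=
      T.toSimplicialComplex.down_closed K.2.1 hβK hne
    refine T.coeff_eq_zero_of_vanish_hull (hp K) hβK hne (fun x hx => ?_) Finset.Subset.rfl
    rw [← hpx K]
    by_cases hc : 2 ≤ β.support.card
    · by_cases hQβ : Q β.support
      · exact absurd ⟨⟨β, hface, hdeg, hc, hQβ⟩, rfl⟩ hn
      · exact hQ _ hface hQβ K x (hull_mono hβK hx) hx
    · have h1 : β.support.card = 1 := by
        have := hne.card_pos
        omega
      obtain ⟨z, hz⟩ := Finset.card_eq_one.1 h1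
      rw [hz, hull, Finset.coe_singleton, convexHull_singleton] at hx
      rw [hx]
      exact hvert K z (hβK (by simp [hz]))
  have hsum : u = ∑ β : T.BernIndex k Q, b β • (aeval T.hat (monomial β.1 (1 : ℝ)) : T.Broken) := by
    funext K x
    rw [Finset.sum_apply, Finset.sum_apply]
    simp only [Pi.smul_apply, smul_eq_mul, T.aeval_hat_apply, eval_monomial, one_mul, Finsupp.prod]
    rw [hpx K, eval_eq]
    set w : E d → ℝ := fun z => T.bary K z x
    have hw : ∀ z, z ∉ K.1 → w z = 0 := fun z hz => T.bary_of_notMem K hz x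
    -- The two sums are compared over the union of their index sets; extra terms have zero
    -- coefficient or a factor λ_z with z outside K.
    set B : Finset (E d →₀ ℕ) := Finset.univ.image fun β : T.BernIndex k Q => β.1
    trans ∑ β ∈ (p K).support ∪ B, coeff β (p K) * ∏ i ∈ β.support, w i ^ β i
    · refine Finset.sum_subset Finset.subset_union_left fun β _ hβ => ?_
      rw [notMem_support_iff.1 hβ, zero_mul]
    · trans ∑ β ∈ B, coeff β (p K) * ∏ i ∈ β.support, w i ^ β i
      · refine (Finset.sum_subset Finset.subset_union_right fun β hβ hβB => ?_).symm
        have hβp : β ∈ (p K).support := (Finset.mem_union.1 hβ).resolve_right hβB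
        by_cases hβK : β.support ⊆ K.1
        · rw [hzero K β hβK hβp fun ⟨γ, hγ⟩ => hβB
            (Finset.mem_image.2 ⟨γ, Finset.mem_univ _, hγ⟩), zero_mul]
        · rw [prod_pow_eq_zero hβK hw, mul_zero]
      · rw [Finset.sum_image fun β _ β' _ h => Subtype.ext h]
        refine Finset.sum_congr rfl fun β _ => ?_
        by_cases hβK : β.1.support ⊆ K.1
        · rw [hb β K hβK]
        · rw [prod_pow_eq_zero hβK hw, mul_zero, mul_zero]
  rw [hsum]
  exact Submodule.sum_mem _ fun β _ =>
    Submodule.smul_mem _ _ (Submodule.subset_span (mem_range_self β))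

/-- A continuous piecewise polynomial that vanishes at the vertices, and on the faces without the
property `Q`, is a combination of the functions `B_{τ,α}` for the faces `τ` with this property. -/
theorem mem_span_confBasis (hd : 2 ≤ d) (hk : Odd k) {Q : Finset (E d) → Prop}
    (hmono : ∀ σ τ, σ ⊆ τ → Q σ → Q τ) {u : T.Broken}
    (hu : u ∈ T.S k) (hvert : ∀ K : T.Cell, ∀ z ∈ K.1, u K z = 0)
    (hQ : ∀ σ ∈ T.faces, ¬ Q σ → ∀ K : T.Cell, ∀ x ∈ hull K.1, x ∈ hull σ → u K x = 0) :
    u ∈ Submodule.span ℝ (range fun i : {i : T.ConfIndex k // Q i.face.1} =>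
      T.confBasis A i.1) := by
  let f : {i : T.ConfIndex k // Q i.face.1} → T.FullIndex k := fun i => Sum.inl i.1
  have hf : Function.Injective f := fun i j h => Subtype.ext (Sum.inl_injective h)
  have hli : LinearIndependent ℝ fun i : {i : T.ConfIndex k // Q i.face.1} =>
      T.confBasis A i.1 := (T.linearIndependent_crBasis A hd hk).comp f hf
  have hcard : Fintype.card (T.BernIndex k Q) ≤
      Fintype.card {i : T.ConfIndex k // Q i.face.1} :=
    Fintype.card_le_of_injective _ (T.bernToConf_injective A Q)
  have hmem := T.mem_span_bernstein hk.pos Q hu hvert hQ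
  refine span_le_span_of_card_le hli ?_ hcard hmem
  intro i
  refine T.mem_span_bernstein hk.pos Q (T.confBasis_mem_S A i.1)
    (fun K z hz => T.confBasis_vertex A i.1 hz) fun σ hσ hQσ K x hx hxσ => ?_
  -- `Q` passes to larger faces, so a face without it contains no face that has it.
  have hns : ¬ i.1.face.1 ⊆ σ := fun h => hQσ (hmono _ _ h i.2)
  obtain ⟨K', hK'⟩ := T.exists_cell hσ
  obtain ⟨z, hz, hzσ⟩ := Finset.not_subset.1 hns
  refine T.confBasis_eq_zero A i.1 hz ?_
  rw [T.bary_eq_of_mem hx (hull_mono hK' hxσ)]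
  exact ((T.mem_hull_iff K' hK').1 hxσ).2 z hzσ

end Mesh

namespace Mesh

open MvPolynomial

variable {d : ℕ} {Ω : Set (E d)} (T : Mesh Ω) (A : T.Numbering) {k : ℕ}

/-! ### The spans of the basis functions -/

/-- The continuous function `1 - P_k^{(0,d-2)}(1 - 2 φ_z)`. -/
def vertexFun (k : ℕ) (z : E d) : T.Broken :=
  fun K x => 1 - jacobi 0 (d - 2) k (1 - 2 * T.bary K z x)

theorem vertexFun_eq_zero {z : E d} {K : T.Cell} {x : E d} (h : T.bary K z x = 0) :
    T.vertexFun k z K x = 0 := by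
  rw [vertexFun, h, mul_zero, sub_zero, jacobi_zero_one, sub_self]

theorem vertexFun_mem_S (z : E d) : T.vertexFun k z ∈ T.S k := by
  -- With r = 1 and y = 1 - φ_z, the argument 2y/r - 1 is 1 - 2φ_z.
  have h : T.vertexFun k z =
      aeval T.hat (1 - jacobiHomAlg 0 (d - 2) k (1 - X z) 1 : MvPolynomial (E d) ℝ) := by
    funext K x
    rw [T.aeval_hat_apply, ← MvPolynomial.aeval_eq_eval]
    rw [map_sub, map_jacobiHomAlg, map_sub, map_one, aeval_X, jacobiHomAlg_real,
      jacobiHom_eq _ _ _ _ _ one_ne_zero, one_pow, one_mul, vertexFun]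
    congr 2
    ring
  have h1 : (1 : MvPolynomial (E d) ℝ).totalDegree ≤ 1 := by simp
  rw [h]
  refine T.aeval_hat_mem_S ((totalDegree_sub _ _).trans (max_le (by simp) ?_))
  exact totalDegree_jacobiHomAlg_le _ _ _
    ((totalDegree_sub _ _).trans (max_le h1 (by simp))) h1

/-- On a cell containing z, the facets through z are those opposite the other vertices. This is how
discontinuous facet functions replace the nodal functions absent from the basis. -/
theorem vertexFun_eq_sum (hd : 2 ≤ d) (z : E d) :
    T.vertexFun k z = ∑ F ∈ Finset.univ.filter (fun F : T.Facet => z ∈ F.1), T.crFacet k F := by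
  funext K x
  rw [Finset.sum_apply, Finset.sum_apply, Finset.sum_filter]
  rw [T.sum_facet_eq hd K (fun F => if z ∈ F.1 then T.crFacet k F K x else 0) fun F hF => by
    rw [T.crFacet_eq_zero hF, ite_self]]
  by_cases hz : z ∈ K.1
  · rw [vertexFun, ← T.sum_crFacet hd K ⟨z, hz⟩, ← Finset.sum_filter]
    refine Finset.sum_congr ?_ fun _ _ => rfl
    ext y
    simp [facetOpp, hz, eq_comm, Subtype.ext_iff]
  · rw [T.vertexFun_eq_zero (T.bary_of_notMem K hz x)]
    exact (Finset.sum_eq_zero fun y _ => if_neg fun h => hz (Finset.mem_of_mem_erase h)).symm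

/-- Subtracting an interpolant at the vertices built from the functions `vertexFun` leaves a
combination of the B_{τ,α}. At vertices without `Q` the function is already zero. -/
theorem mem_span_of_mem_S (hd : 2 ≤ d) (hk : Odd k) {Q : Finset (E d) → Prop}
    (hmono : ∀ σ τ, σ ⊆ τ → Q σ → Q τ) {u : T.Broken} (hu : u ∈ T.S k)
    (hQ : ∀ σ ∈ T.faces, ¬ Q σ → ∀ K : T.Cell, ∀ x ∈ hull K.1, x ∈ hull σ → u K x = 0) :
    u ∈ Submodule.span ℝ (range fun i : {i : T.ConfIndex k // Q i.face.1} =>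
      T.confBasis A i.1) ⊔ Submodule.span ℝ (T.crFacet k '' {F | Q F.1}) := by
  obtain ⟨v, -, hv⟩ := hu.2
  -- The value of `vertexFun` at its own vertex.
  set a : ℝ := 1 + ((k + (d - 2)).choose k : ℝ) with ha
  have ha0 : a ≠ 0 := by positivity
  set V : Finset (E d) := (T.finite_faces.toFinset.biUnion id).filter fun z => Q {z} with hV
  have hmemV : ∀ (K : T.Cell) (z : E d), z ∈ K.1 → (z ∈ V ↔ Q {z}) := by
    intro K z hz
    rw [hV, Finset.mem_filter, and_iff_right]
    exact Finset.mem_biUnion.2 ⟨K.1, T.finite_faces.mem_toFinset.2 K.2.1, hz⟩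
  set s : T.Broken := ∑ z ∈ V, (v z / a) • T.vertexFun k z with hs
  have hsx : ∀ K x, s K x = ∑ z ∈ V, v z / a * T.vertexFun k z K x := fun K x => by
    rw [hs, Finset.sum_apply, Finset.sum_apply]
    rfl
  have hsS : s ∈ T.S k :=
    Submodule.sum_mem _ fun z _ => Submodule.smul_mem _ _ (T.vertexFun_mem_S z)
  have hsspan : s ∈ Submodule.span ℝ (T.crFacet k '' {F | Q F.1}) := by
    refine Submodule.sum_mem _ fun z hz => Submodule.smul_mem _ _ ?_
    rw [T.vertexFun_eq_sum hd]
    refine Submodule.sum_mem _ fun F hF => Submodule.subset_span ⟨F, ?_, rfl⟩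
    exact hmono {z} F.1 (Finset.singleton_subset_iff.2 (Finset.mem_filter.1 hF).2)
      (Finset.mem_filter.1 hz).2
  rw [← sub_add_cancel u s]
  refine Submodule.add_mem_sup (T.mem_span_confBasis A hd hk hmono (Submodule.sub_mem _ hu hsS)
    (fun K y hy => ?_) fun σ hσ hQσ K x hx hxσ => ?_) hsspan
  · have hval : ∀ z, v z / a * T.vertexFun k z K y = if z = y then v z else 0 := by
      intro z
      rw [vertexFun, T.jacobi_vertex hk hy, ← ha]
      split_ifs <;> field_simp <;> ring
    rw [Pi.sub_apply, Pi.sub_apply, hsx, Finset.sum_congr rfl fun z _ => hval z,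
      Finset.sum_ite_eq']
    split_ifs with hyV
    · rw [hv K y (mem_hull_of_mem hy), sub_self]
    · rw [sub_zero]
      exact hQ {y} (T.toSimplicialComplex.down_closed K.2.1 (by simpa using hy) (by simp))
        (fun h => hyV ((hmemV K y hy).2 h)) K y (mem_hull_of_mem hy) (mem_hull_of_mem (by simp))
  · rw [Pi.sub_apply, Pi.sub_apply, hsx, hQ σ hσ hQσ K x hx hxσ, Finset.sum_eq_zero, sub_zero]
    intro z hz
    have hzσ : z ∉ σ := fun h => hQσ (hmono {z} σ (by simpa using h) (Finset.mem_filter.1 hz).2)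
    obtain ⟨K', hK'⟩ := T.exists_cell hσ
    rw [T.vertexFun_eq_zero, mul_zero]
    rw [T.bary_eq_of_mem hx (hull_mono hK' hxσ)]
    exact ((T.mem_hull_iff K' hK').1 hxσ).2 z hzσ

theorem CR_of_odd (hk : Odd k) :
    T.CR k = T.S k ⊔ Submodule.span ℝ (range (T.crFacet k)) :=
  if_neg (Nat.not_even_iff_odd.2 hk)

theorem CR0_of_odd (hk : Odd k) : T.CR0 k =
    T.S0 k ⊔ Submodule.span ℝ (T.crFacet k '' {F | ¬ OnBoundary Ω F.1}) :=
  if_neg (Nat.not_even_iff_odd.2 hk)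

theorem span_crBasis (hd : 2 ≤ d) (hk : Odd k) :
    Submodule.span ℝ (range (T.crBasis A k)) = T.CR k := by
  rw [T.CR_of_odd hk]
  apply le_antisymm
  · rw [Submodule.span_le, range_subset_iff]
    rintro (i | F)
    · exact Submodule.mem_sup_left (T.confBasis_mem_S A i)
    · exact Submodule.mem_sup_right (Submodule.subset_span (mem_range_self F))
  · refine sup_le (fun u hu => ?_) (Submodule.span_mono ?_)
    · have h := T.mem_span_of_mem_S A hd hk (Q := fun _ => True) (fun _ _ _ _ => trivial) hu
        fun _ _ h => absurd trivial h
      refine (sup_le (Submodule.span_mono ?_) (Submodule.span_mono ?_) :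
        _ ≤ Submodule.span ℝ (range (T.crBasis A k))) h
      · rintro _ ⟨i, rfl⟩
        exact ⟨Sum.inl i.1, rfl⟩
      · rintro _ ⟨F, -, rfl⟩
        exact ⟨Sum.inr F, rfl⟩
    · rintro _ ⟨F, rfl⟩
      exact ⟨Sum.inr F, rfl⟩

/-- Were it nonzero at a boundary point, τ would lie in the carrier of that point and hence in ∂Ω.
-/
theorem confBasis_mem_S0 (hΩ : IsMeshDomain Ω) {i : T.ConfIndex k}
    (hi : ¬ OnBoundary Ω i.face.1) : T.confBasis A i ∈ T.S0 k := by
  refine ⟨T.confBasis_mem_S A i, fun K x hx hxf => ?_⟩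
  by_contra hne
  have hpos : ∀ z ∈ i.face.1, T.bary K z x ≠ 0 := fun z hz h =>
    hne (T.confBasis_eq_zero A i hz h)
  have hsub : i.face.1 ⊆ K.1 := by
    by_contra h
    exact hne (T.confBasis_eq_zero_of_not_subset_cell A i h x)
  exact hi (T.onBoundary_of_bary_ne_zero hΩ hx hxf hsub hpos)

theorem span_crBasis0 (hd : 2 ≤ d) (hk : Odd k) (hΩ : IsMeshDomain Ω) :
    Submodule.span ℝ (range (T.crBasis0 A k)) = T.CR0 k := by
  rw [T.CR0_of_odd hk]
  apply le_antisymm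
  · rw [Submodule.span_le, range_subset_iff]
    rintro (i | F)
    · exact Submodule.mem_sup_left (T.confBasis_mem_S0 A hΩ i.2)
    · exact Submodule.mem_sup_right (Submodule.subset_span ⟨F.1, F.2, rfl⟩)
  · refine sup_le (fun u hu => ?_) (Submodule.span_mono ?_)
    · have h := T.mem_span_of_mem_S A hd hk (Q := fun σ => ¬ OnBoundary Ω σ)
        (fun σ τ hστ hσ hτ => hσ (hτ.mono hστ)) hu.1
        fun σ _ hQ K x hx hxσ => hu.2 K x hx (not_not.1 hQ hxσ)
      refine (sup_le (Submodule.span_mono ?_) (Submodule.span_mono ?_) :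
        _ ≤ Submodule.span ℝ (range (T.crBasis0 A k))) h
      · rintro _ ⟨i, rfl⟩
        exact ⟨Sum.inl i, rfl⟩
      · rintro _ ⟨F, hF, rfl⟩
        exact ⟨Sum.inr ⟨F, hF⟩, rfl⟩
    · rintro _ ⟨F, hF, rfl⟩
      exact ⟨Sum.inr ⟨F, hF⟩, rfl⟩

theorem continuous_crBasis (i : T.FullIndex k) (K : T.Cell) : Continuous (T.crBasis A k i K) := by
  rcases i with i | F
  exacts [T.continuous_confBasis A i K, T.continuous_crFacet F K]

theorem continuous_of_mem_CR (hd : 2 ≤ d) (hk : Odd k) {u : T.Broken} (hu : u ∈ T.CR k)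
    (K : T.Cell) : Continuous (u K) := by
  have A : T.Numbering := fun _ τ => (Finset.equivFinOfCardEq τ.2.2).symm
  rw [← T.span_crBasis A hd hk] at hu
  induction hu using Submodule.span_induction with
  | mem u hu =>
    obtain ⟨i, rfl⟩ := hu
    exact T.continuous_crBasis A i K
  | zero => exact continuous_const
  | add u v _ _ hu hv => exact hu.add hv
  | smul c u _ hu => exact hu.const_smul c

theorem CR0_le_CR (hk : Odd k) : T.CR0 k ≤ T.CR k := by
  rw [T.CR_of_odd hk, T.CR0_of_odd hk]
  exact sup_le_sup (fun u hu => hu.1) (Submodule.span_mono (image_subset_range _ _))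

end Mesh

/-! ### Dual families and square integrable weights. -/

/-- A finite linearly independent family in a real Hilbert space has a dual family. -/
theorem exists_inner_dual {ι H : Type*} [Fintype ι] [NormedAddCommGroup H] [InnerProductSpace ℝ H]
    {v : ι → H} (hv : LinearIndependent ℝ v) :
    ∃ w : ι → H, ∀ i j, inner ℝ (w i) (v j) = if i = j then 1 else 0 := by
  let b := Module.Basis.span hv
  have : FiniteDimensional ℝ (Submodule.span ℝ (range v)) :=
    FiniteDimensional.span_of_finite ℝ (finite_range v)
  -- Riesz representatives of the coordinate functionals on the finite-dimensional span.
  refine ⟨fun i => ((InnerProductSpace.toDual ℝ (Submodule.span ℝ (range v))).symm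
    (b.coord i).toContinuousLinearMap : Submodule.span ℝ (range v)), fun i j => ?_⟩
  have h1 : v j = (b j : H) := congrArg Subtype.val (Module.Basis.span_apply hv j).symm
  rw [h1, ← Submodule.coe_inner, InnerProductSpace.toDual_symm_apply]
  simp [Finsupp.single_apply, eq_comm]

/-- Existence of square integrable weights whose functionals are bidual to a given family. -/
theorem exists_memLp_dual {ι X : Type*} [Fintype ι] [MeasurableSpace X] (μ : Measure X)
    (f : ι → X → ℝ) (hf : ∀ i, MemLp (f i) 2 μ)
    (h : ∀ c : ι → ℝ, (∀ᵐ x ∂μ, ∑ i, c i * f i x = 0) → ∀ i, c i = 0) :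
    ∃ g : ι → X → ℝ, (∀ i, MemLp (g i) 2 μ) ∧
      ∀ i j, ∫ x, g i x * f j x ∂μ = if i = j then 1 else 0 := by
  have hli : LinearIndependent ℝ fun i => (hf i).toLp (f i) := by
    rw [Fintype.linearIndependent_iff]
    intro c hc
    refine h c ?_
    have h1 : MemLp (fun x => ∑ i, c i * f i x) 2 μ :=
      memLp_finsetSum _ fun i _ => (hf i).const_mul (c i)
    have h2 : h1.toLp = ∑ i, c i • (hf i).toLp (f i) := by
      rw [Lp.ext_iff]
      refine h1.coeFn_toLp.trans ?_
      have h3 := Lp.coeFn_finsetSum (μ := μ) (p := 2) Finset.univ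
        (fun i => c i • (hf i).toLp (f i))
      have h4 : ∀ᵐ x ∂μ, ∀ i, (c i • (hf i).toLp (f i) : Lp ℝ 2 μ) x = c i * f i x := by
        rw [ae_all_iff]
        intro i
        filter_upwards [Lp.coeFn_smul (c i) ((hf i).toLp (f i)), (hf i).coeFn_toLp] with x hx hx'
        rw [hx, Pi.smul_apply, hx', smul_eq_mul]
      filter_upwards [h3, h4] with x hx hx'
      rw [hx, Finset.sum_apply]
      exact Finset.sum_congr rfl fun i _ => (hx' i).symm
    rw [hc] at h2
    have h5 := h1.coeFn_toLp
    rw [h2] at h5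
    filter_upwards [h5, Lp.coeFn_zero ℝ 2 μ] with x hx hx'
    rw [← hx, hx', Pi.zero_apply]
  obtain ⟨w, hw⟩ := exists_inner_dual hli
  refine ⟨fun i => w i, fun i => Lp.memLp (w i), fun i j => ?_⟩
  rw [← hw i j, L2.inner_def]
  refine integral_congr_ae ?_
  filter_upwards [(hf j).coeFn_toLp] with x hx
  rw [hx]
  simp [mul_comm]

theorem memLp_of_continuous_of_isCompact {X : Type*} [TopologicalSpace X] [MeasurableSpace X]
    [OpensMeasurableSpace X] [T2Space X] {μ : Measure X} {s : Set X} (hs : IsCompact s) (hμ : μ s ≠ ⊤)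
    {f : X → ℝ} (hf : Continuous f) : MemLp f 2 (μ.restrict s) := by
  have : IsFiniteMeasure (μ.restrict s) := ⟨by
    rw [Measure.restrict_apply_univ]
    exact hμ.lt_top⟩
  obtain ⟨C, hC⟩ := hs.exists_bound_of_continuousOn hf.continuousOn
  refine MemLp.of_bound hf.measurable.aestronglyMeasurable C ?_
  filter_upwards [ae_restrict_mem hs.measurableSet] with x hx using hC x hx

theorem exists_lipschitzWith_linear_add_const {V W : Type*} [NormedAddCommGroup V]
    [NormedSpace ℝ V] [FiniteDimensional ℝ V] [NormedAddCommGroup W] [NormedSpace ℝ W]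
    (L : V →ₗ[ℝ] W) (c : W) {f : V → W} (hf : ∀ x, f x = L x + c) :
    ∃ C : NNReal, LipschitzWith C f := by
  rw [show f = fun x => L.toContinuousLinearMap x + c from funext hf]
  exact ⟨_, L.toContinuousLinearMap.lipschitz.add (LipschitzWith.const c)⟩

namespace Mesh

variable {d : ℕ} {Ω : Set (E d)} (T : Mesh Ω)

/-! ### The measures on cells and facets -/

theorem interior_hull_nonempty (K : T.Cell) : (interior (hull K.1)).Nonempty := by
  have h := (interior_convexHull_nonempty_iff_affineSpan_eq_top (s := (K.1 : Set (E d)))).2 (by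
    have := (T.cellBasis K).tot
    have hr : range (T.cellBasis K) = (K.1 : Set (E d)) := Subtype.range_coe
    rwa [hr] at this)
  exact h

/-- A cell lies in the closure of its interior, so almost everywhere zero and continuity suffice. -/
theorem eq_zero_of_ae_cell (K : T.Cell) {f : E d → ℝ} (hf : Continuous f)
    (h : ∀ᵐ x ∂(volume.restrict (hull K.1)), f x = 0) : ∀ x ∈ hull K.1, f x = 0 := by
  refine Measure.eqOn_of_ae_eq h hf.continuousOn continuousOn_const ?_
  have hc : Convex ℝ (hull K.1) := convex_convexHull ℝ _
  rw [hc.closure_interior_eq_closure_of_nonempty_interior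
    (T.interior_hull_nonempty K)]
  exact subset_closure

/-- A facet of a cell as bi-Lipschitz image of the unit simplex in `ℝ^{d-1}`. -/
theorem exists_facet_param {K : T.Cell} {F : T.Facet} (hF : F.1 ⊆ K.1) :
    ∃ (ψ : (Fin (d - 1) → ℝ) → E d) (π : E d → Fin (d - 1) → ℝ) (C D : NNReal),
      LipschitzWith C ψ ∧ LipschitzWith D π ∧
      (∀ c : Fin (d - 1) → ℝ, (∀ i, 0 ≤ c i) → ∑ i, c i ≤ 1 → ψ c ∈ hull F.1 ∧ π (ψ c) = c) ∧
      ∀ x ∈ hull F.1, (∀ i, 0 ≤ π x i) ∧ ∑ i, π x i ≤ 1 ∧ ψ (π x) = x := by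
  let a : Fin (d - 1 + 1) ≃ F.1 := (Finset.equivFinOfCardEq F.2.2).symm
  -- The vertex a_0 is the origin of the parametrization, and `π` reads off the coordinates of the
  -- other vertices. Both maps are affine, hence Lipschitz.
  let ψ : (Fin (d - 1) → ℝ) → E d := fun c =>
    (1 - ∑ i, c i) • (a 0 : E d) + ∑ i, c i • (a i.succ : E d)
  let π : E d → Fin (d - 1) → ℝ := fun x i => T.bary K (a i.succ) x
  have hsumF : ∀ g : E d → E d, ∑ y ∈ F.1, g y = g (a 0) + ∑ i : Fin (d - 1), g (a i.succ) := by
    intro g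
    rw [← Finset.sum_coe_sort, ← Equiv.sum_comp a, Fin.sum_univ_succ]
  have hsumF' : ∀ g : E d → ℝ, ∑ y ∈ F.1, g y = g (a 0) + ∑ i : Fin (d - 1), g (a i.succ) := by
    intro g
    rw [← Finset.sum_coe_sort, ← Equiv.sum_comp a, Fin.sum_univ_succ]
  have hψ : ∃ C, LipschitzWith C ψ := by
    refine exists_lipschitzWith_linear_add_const
      (∑ i, (LinearMap.proj i : (Fin (d - 1) → ℝ) →ₗ[ℝ] ℝ).smulRight
        ((a i.succ : E d) - (a 0 : E d))) (a 0 : E d) fun c => ?_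
    simp only [ψ, LinearMap.sum_apply, LinearMap.smulRight_apply, LinearMap.proj_apply, smul_sub,
      Finset.sum_sub_distrib, ← Finset.sum_smul, sub_smul, one_smul]
    abel
  have hπ : ∃ D, LipschitzWith D π := by
    refine exists_lipschitzWith_linear_add_const (LinearMap.pi fun i : Fin (d - 1) =>
      ((T.cellBasis K).coord ⟨a i.succ, hF (a i.succ).2⟩).linear) (π 0) fun x => ?_
    funext i
    simp only [π, Pi.add_apply, LinearMap.pi_apply, T.bary_of_mem K (hF (a i.succ).2)]
    have := ((T.cellBasis K).coord ⟨a i.succ, hF (a i.succ).2⟩).map_vadd 0 x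
    simpa using this
  obtain ⟨C, hC⟩ := hψ
  obtain ⟨D, hD⟩ := hπ
  refine ⟨ψ, π, C, D, hC, hD, fun c hc0 hc1 => ?_, fun x hx => ?_⟩
  · let w : E d → ℝ := fun z => if h : z ∈ F.1 then
      (Fin.cons (1 - ∑ i, c i) c : Fin (d - 1 + 1) → ℝ) (a.symm ⟨z, h⟩) else 0
    have hwa : ∀ j, w (a j) = (Fin.cons (1 - ∑ i, c i) c : Fin (d - 1 + 1) → ℝ) j := fun j => by
      simp [w]
    have hw1 : ∑ y ∈ F.1, w y = 1 := by
      rw [hsumF']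
      simp only [hwa, Fin.cons_zero, Fin.cons_succ]
      ring
    have hψw : ψ c = ∑ y ∈ F.1, w y • y := by
      rw [hsumF]
      simp only [hwa, Fin.cons_zero, Fin.cons_succ, ψ]
    constructor
    · rw [hψw, hull, Finset.mem_convexHull']
      refine ⟨w, fun y hy => ?_, hw1, rfl⟩
      obtain ⟨j, hj⟩ := a.surjective ⟨y, hy⟩
      have : y = a j := by rw [hj]
      rw [this, hwa]
      refine Fin.cases ?_ (fun i => ?_) j
      · simpa using hc1
      · simpa using hc0 i
    · funext i
      simp only [π]
      rw [hψw, T.bary_sum_smul K hF w hw1, if_pos (a i.succ).2, hwa, Fin.cons_succ]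
  · obtain ⟨h0, h1⟩ := (T.mem_hull_iff K hF).1 hx
    have hs : ∑ y ∈ F.1, T.bary K y x = 1 := by
      rw [← T.sum_bary K x]
      exact Finset.sum_subset hF fun z _ hz => h1 z hz
    rw [hsumF' fun y => T.bary K y x] at hs
    refine ⟨fun i => h0 _, ?_, ?_⟩
    · have := h0 (a 0)
      simp only [π]
      linarith
    · have hx' : ∑ y ∈ F.1, T.bary K y x • y = x := by
        conv_rhs => rw [← T.sum_bary_smul K x]
        exact Finset.sum_subset hF fun z _ hz => by rw [h1 z hz, zero_smul]
      conv_rhs => rw [← hx', hsumF fun y => T.bary K y x • y]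
      simp only [ψ, π]
      congr 2
      linarith

/-- With the supremum norm, Hausdorff measure is exactly Lebesgue measure; hence the parameter space
Fin (d-1) → ℝ. -/
theorem hausdorffMeasure_fin (hd : 2 ≤ d) :
    (Measure.hausdorffMeasure ((d : ℝ) - 1) : Measure (Fin (d - 1) → ℝ)) = volume := by
  rw [← hausdorffMeasure_pi_real, Fintype.card_fin, Nat.cast_sub (by omega), Nat.cast_one]

/-- The unit simplex in `ℝ^n`. -/
def unitSimplex (n : ℕ) : Set (Fin n → ℝ) := {c | (∀ i, 0 ≤ c i) ∧ ∑ i, c i ≤ 1}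

theorem convex_unitSimplex (n : ℕ) : Convex ℝ (unitSimplex n) := by
  rintro x ⟨hx0, hx1⟩ y ⟨hy0, hy1⟩ s t hs ht hst
  refine ⟨fun i => ?_, ?_⟩
  · exact add_nonneg (mul_nonneg hs (hx0 i)) (mul_nonneg ht (hy0 i))
  · simp only [Pi.add_apply, Pi.smul_apply, smul_eq_mul, Finset.sum_add_distrib, ← Finset.mul_sum]
    nlinarith

theorem isCompact_unitSimplex (n : ℕ) : IsCompact (unitSimplex n) := by
  refine (isCompact_univ_pi fun _ : Fin n => isCompact_Icc (a := (0 : ℝ)) (b := 1)).of_isClosed_subset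
    ?_ ?_
  · have : unitSimplex n = (⋂ i, {c | 0 ≤ c i}) ∩ {c | ∑ i, c i ≤ 1} := by
      ext c
      simp [unitSimplex]
    rw [this]
    exact (isClosed_iInter fun i => isClosed_le continuous_const (continuous_apply i)).inter
      (isClosed_le (by fun_prop) continuous_const)
  · intro c hc i _
    exact ⟨hc.1 i, (Finset.single_le_sum (fun j _ => hc.1 j) (Finset.mem_univ i)).trans hc.2⟩

theorem interior_unitSimplex_nonempty (n : ℕ) : (interior (unitSimplex n)).Nonempty := by
  have hopen : IsOpen ({c : Fin n → ℝ | ∀ i, 0 < c i} ∩ {c | ∑ i, c i < 1}) := by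
    have : {c : Fin n → ℝ | ∀ i, 0 < c i} = ⋂ i, {c | 0 < c i} := by
      ext c
      simp
    rw [this]
    exact (isOpen_iInter_of_finite fun i => isOpen_lt continuous_const (continuous_apply i)).inter
      (isOpen_lt (by fun_prop) continuous_const)
  have hsub : {c : Fin n → ℝ | ∀ i, 0 < c i} ∩ {c | ∑ i, c i < 1} ⊆ unitSimplex n :=
    fun c hc => ⟨fun i => (hc.1 i).le, le_of_lt hc.2⟩
  refine ⟨fun _ => 1 / (n + 1), interior_maximal hsub hopen ⟨fun i => ?_, ?_⟩⟩
  · change (0 : ℝ) < 1 / (n + 1)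
    positivity
  · change ∑ _i : Fin n, (1 / (n + 1) : ℝ) < 1
    rw [Finset.sum_const, Finset.card_univ, Fintype.card_fin, nsmul_eq_mul, mul_one_div,
      div_lt_one (by positivity)]
    linarith

theorem hausdorffMeasure_facet_ne_top (hd : 2 ≤ d) (F : T.Facet) :
    (Measure.hausdorffMeasure ((d : ℝ) - 1) : Measure (E d)) (hull F.1) ≠ ⊤ := by
  obtain ⟨K, hK⟩ := T.exists_cell F.2.1
  obtain ⟨ψ, π, C, D, hC, -, -, h⟩ := T.exists_facet_param hK
  have hd1 : (0 : ℝ) ≤ (d : ℝ) - 1 := by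
    have : (2 : ℝ) ≤ d := by exact_mod_cast hd
    linarith
  have hsub : hull F.1 ⊆ ψ '' unitSimplex (d - 1) := fun x hx =>
    ⟨π x, ⟨(h x hx).1, (h x hx).2.1⟩, (h x hx).2.2⟩
  refine ne_top_of_le_ne_top ?_ ((measure_mono hsub).trans (hC.hausdorffMeasure_image_le hd1 _))
  rw [hausdorffMeasure_fin hd]
  exact ENNReal.mul_ne_top (ENNReal.rpow_ne_top_of_nonneg hd1 ENNReal.coe_ne_top)
    (isCompact_unitSimplex _).measure_lt_top.ne

/-- The Lipschitz map `π` carries the exceptional null set to a null set of parameters, which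
reduces the claim to a continuous function on the unit simplex. -/
theorem eq_zero_of_ae_facet (hd : 2 ≤ d) (F : T.Facet) {f : E d → ℝ} (hf : Continuous f)
    (h : ∀ᵐ x ∂((Measure.hausdorffMeasure ((d : ℝ) - 1)).restrict (hull F.1)), f x = 0) :
    ∀ x ∈ hull F.1, f x = 0 := by
  obtain ⟨K, hK⟩ := T.exists_cell F.2.1
  obtain ⟨ψ, π, C, D, hC, hD, h1, h2⟩ := T.exists_facet_param hK
  have hd1 : (0 : ℝ) ≤ (d : ℝ) - 1 := by
    have : (2 : ℝ) ≤ d := by exact_mod_cast hd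
    linarith
  have hnull : (Measure.hausdorffMeasure ((d : ℝ) - 1) : Measure (E d))
      {x | ¬ (x ∈ hull F.1 → f x = 0)} = 0 :=
    (ae_restrict_iff' (isCompact_hull F.1).measurableSet).1 h
  have hnull' : ∀ᵐ c ∂(volume.restrict (unitSimplex (d - 1))), f (ψ c) = 0 := by
    rw [ae_restrict_iff' (isCompact_unitSimplex _).measurableSet]
    refine measure_mono_null (t := π '' {x | ¬ (x ∈ hull F.1 → f x = 0)}) ?_ ?_
    · intro c hc
      have hc' : ¬ (c ∈ unitSimplex (d - 1) → f (ψ c) = 0) := hc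
      push Not at hc'
      have := h1 c hc'.1.1 hc'.1.2
      exact ⟨ψ c, fun hh => hc'.2 (hh this.1), this.2⟩
    · rw [← hausdorffMeasure_fin hd]
      refine le_antisymm ((hD.hausdorffMeasure_image_le hd1 _).trans ?_) zero_le
      rw [hnull, mul_zero]
  have hzero : EqOn (fun c => f (ψ c)) 0 (unitSimplex (d - 1)) := by
    refine Measure.eqOn_of_ae_eq hnull' (hf.comp hC.continuous).continuousOn continuousOn_const ?_
    rw [(convex_unitSimplex _).closure_interior_eq_closure_of_nonempty_interior
      (interior_unitSimplex_nonempty _)]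
    exact subset_closure
  intro x hx
  obtain ⟨hx0, hx1, hx2⟩ := h2 x hx
  rw [← hx2]
  exact hzero ⟨hx0, hx1⟩

end Mesh

theorem sum_subtype_eq_sum_dite {ι : Type*} [Fintype ι] (p : ι → Prop)
    [Fintype {i // p i}] (f : {i // p i} → ℝ) :
    ∑ i, f i = ∑ i, if h : p i then f ⟨i, h⟩ else 0 := by
  have h := Finset.sum_dite (s := Finset.univ) (p := p) (fun i h => f ⟨i, h⟩) fun _ _ => 0
  rw [h, Finset.sum_const_zero, add_zero]
  exact Finset.sum_bij (fun i _ => ⟨i.1, by simp [i.2]⟩) (fun _ _ => Finset.mem_attach _ _)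
    (fun i _ j _ hij => Subtype.ext (Subtype.mk.inj hij))
    (fun j _ => ⟨⟨j.1, (Finset.mem_filter.1 j.2).2⟩, Finset.mem_univ _, rfl⟩) fun _ _ => rfl

namespace Mesh

variable {d : ℕ} {Ω : Set (E d)} (T : Mesh Ω) (A : T.Numbering) {k : ℕ}

theorem subset_adj (F : T.Facet) : F.1 ⊆ (T.adj F).1 := (T.exists_cell F.2.1).choose_spec

/-! ### Existence of weights -/

/-- Weights that are bidual to the basis functions for the faces `τ ⊆ σ` of a cell and for a set
of facets of this cell. -/
theorem exists_local_weights (hd : 2 ≤ d) (hk : Odd k) {K : T.Cell} {σ : Finset (E d)}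
    (hσK : σ ⊆ K.1) (N : Set T.Facet) (hNK : ∀ F ∈ N, F.1 ⊆ K.1)
    (hσ : σ = K.1 ∨ ∃ y z : K.1, z ≠ y ∧ σ = K.1.erase y ∧ T.facetOpp hd K z ∉ N)
    (μ : Measure (E d)) (hμL : ∀ f : E d → ℝ, Continuous f → MemLp f 2 μ)
    (hμ0 : ∀ f : E d → ℝ, Continuous f → (∀ᵐ x ∂μ, f x = 0) → ∀ x ∈ hull σ, f x = 0) :
    ∃ (g : T.ConfIndex k → E d → ℝ) (gCR : T.Facet → E d → ℝ),
      (∀ i, i.face.1 ⊆ σ → MemLp (g i) 2 μ) ∧ (∀ F ∈ N, MemLp (gCR F) 2 μ) ∧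
      (∀ i j : T.ConfIndex k, i.face.1 ⊆ σ → j.face.1 ⊆ σ →
        ∫ x, g i x * T.confBasis A j K x ∂μ = if i = j then 1 else 0) ∧
      (∀ i : T.ConfIndex k, i.face.1 ⊆ σ → ∀ F ∈ N, ∫ x, g i x * T.crFacet k F K x ∂μ = 0) ∧
      (∀ F ∈ N, ∀ j : T.ConfIndex k, j.face.1 ⊆ σ →
        ∫ x, gCR F x * T.confBasis A j K x ∂μ = 0) ∧
      ∀ F ∈ N, ∀ F' ∈ N, ∫ x, gCR F x * T.crFacet k F' K x ∂μ = if F = F' then 1 else 0 := by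
  let f : {i : T.ConfIndex k // i.face.1 ⊆ σ} ⊕ {F : T.Facet // F ∈ N} → E d → ℝ :=
    Sum.elim (fun i => T.confBasis A i.1 K) (fun F => T.crFacet k F.1 K)
  have hcont : ∀ i, Continuous (f i) := by
    rintro (i | F)
    exacts [T.continuous_confBasis A i.1 K, T.continuous_crFacet F.1 K]
  obtain ⟨g, hg, hgf⟩ := exists_memLp_dual μ f (fun i => hμL _ (hcont i)) (fun c hc => by
    have hc' := hμ0 (fun x => ∑ i, c i * f i x)
      (continuous_finsetSum _ fun i _ => continuous_const.mul (hcont i)) hc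
    -- The coefficients are extended by zero, so the facet outside `N` is the disregarded one.
    obtain ⟨h1, h2⟩ := T.local_independent A hd hk hσK
      (fun i => if h : i.face.1 ⊆ σ then c (Sum.inl ⟨i, h⟩) else 0)
      (fun z => if h : T.facetOpp hd K z ∈ N then c (Sum.inr ⟨_, h⟩) else 0)
      (hσ.imp id fun ⟨y, z, hzy, h1, h2⟩ => ⟨y, z, hzy, h1, dif_neg h2⟩)
      (fun i hi => dif_neg hi) fun x hx => by
        refine Eq.trans ?_ (hc' x hx)
        rw [Fintype.sum_sum_type,
          sum_subtype_eq_sum_dite (fun i : T.ConfIndex k => i.face.1 ⊆ σ),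
          sum_subtype_eq_sum_dite (fun F : T.Facet => F ∈ N),
          T.sum_facet_eq hd K (fun F => if h : F ∈ N then c (Sum.inr ⟨F, h⟩) * f (Sum.inr ⟨F, h⟩) x
            else 0) fun F hF => dif_neg fun h => hF (hNK F h)]
        congr 1
        · refine Finset.sum_congr rfl fun i _ => ?_
          split_ifs
          exacts [rfl, zero_mul _]
        · refine Finset.sum_congr rfl fun z _ => ?_
          split_ifs
          exacts [rfl, zero_mul _]
    rintro (⟨i, hi⟩ | ⟨F, hF⟩)
    · have := h1 i
      rwa [dif_pos hi] at this
    · obtain ⟨z, rfl⟩ := T.exists_eq_facetOpp hd K F (hNK F hF)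
      have := h2 z
      rwa [dif_pos hF] at this)
  refine ⟨fun i => if h : i.face.1 ⊆ σ then g (Sum.inl ⟨i, h⟩) else 0,
    fun F => if h : F ∈ N then g (Sum.inr ⟨F, h⟩) else 0, fun i hi => ?_, fun F hF => ?_,
    fun i j hi hj => ?_, fun i hi F hF => ?_, fun F hF j hj => ?_, fun F hF F' hF' => ?_⟩
  · simp only [dif_pos hi]
    exact hg _
  · simp only [dif_pos hF]
    exact hg _
  · simp only [dif_pos hi]
    have := hgf (Sum.inl ⟨i, hi⟩) (Sum.inl ⟨j, hj⟩)
    simpa [f] using this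
  · simp only [dif_pos hi]
    have := hgf (Sum.inl ⟨i, hi⟩) (Sum.inr ⟨F, hF⟩)
    simpa [f] using this
  · simp only [dif_pos hF]
    have := hgf (Sum.inr ⟨F, hF⟩) (Sum.inl ⟨j, hj⟩)
    simpa [f] using this
  · simp only [dif_pos hF]
    have := hgf (Sum.inr ⟨F, hF⟩) (Sum.inr ⟨F', hF'⟩)
    simpa [f] using this

theorem memLp_cell (K : T.Cell) {f : E d → ℝ} (hf : Continuous f) :
    MemLp f 2 (volume.restrict (hull K.1)) :=
  memLp_of_continuous_of_isCompact (isCompact_hull K.1) (isCompact_hull K.1).measure_lt_top.ne hf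

theorem memLp_facet (hd : 2 ≤ d) (F : T.Facet) {f : E d → ℝ} (hf : Continuous f) :
    MemLp f 2 ((Measure.hausdorffMeasure ((d : ℝ) - 1)).restrict (hull F.1)) :=
  memLp_of_continuous_of_isCompact (isCompact_hull F.1) (T.hausdorffMeasure_facet_ne_top hd F) hf

theorem exists_cell_weights (hd : 2 ≤ d) (hk : Odd k) (K : T.Cell) :
    ∃ (g : T.ConfIndex k → E d → ℝ) (gCR : T.Facet → E d → ℝ),
      ∀ w : T.Weights k, w.cell K = g → w.cellCR K = gCR → w.DualOnCell A K := by
  obtain ⟨g, gCR, h1, h2, h3, h4, h5, h6⟩ := T.exists_local_weights A hd hk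
    (Finset.Subset.refl K.1) {F | F.1 ⊆ K.1} (fun F hF => hF) (Or.inl rfl)
    (volume.restrict (hull K.1)) (fun f hf => T.memLp_cell K hf)
    (fun f hf => T.eq_zero_of_ae_cell K hf)
  refine ⟨g, gCR, ?_⟩
  rintro w rfl rfl
  exact ⟨h1, h2, h3, fun i F hi hF => h4 i hi F hF, fun F j hF hj => h5 F hF j hj,
    fun F F' hF hF' => h6 F hF F' hF'⟩

/-- The traces of all facet functions of K are dependent on F, so one inner facet z is left out and
the weights are made dual to the rest, other inner facets included. The dependence then yields the
vanishing at z. -/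
theorem exists_facet_weights (hd : 2 ≤ d) (hk : Odd k) (hΩ : IsMeshDomain Ω)
    (hT : 1 < Nat.card T.Cell) (F : T.BdryFacet) :
    ∃ (g : T.ConfIndex k → E d → ℝ) (gCR : T.Facet → E d → ℝ),
      ∀ w : T.Weights k, w.facet F = g → w.facetCR F = gCR →
        w.DualOnFacet A F ∧ w.KillsInner F := by
  set K := T.adj F.1 with hK
  have hFK : F.1.1 ⊆ K.1 := T.subset_adj F.1
  obtain ⟨y, hy⟩ := T.exists_eq_facetOpp hd K F.1 hFK
  obtain ⟨z, hz⟩ := T.exists_inner_facet hd hΩ hT K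
  have hzy : z ≠ y := by
    rintro rfl
    rw [← hy] at hz
    exact hz F.2
  let N : Set T.Facet := {F' | F'.1 ⊆ K.1 ∧ F' ≠ T.facetOpp hd K z}
  have hbN : ∀ F' : T.Facet, F'.1 ⊆ K.1 → OnBoundary Ω F'.1 → F' ∈ N := fun F' h1 h2 =>
    ⟨h1, fun h => hz (h ▸ h2)⟩
  set μ : Measure (E d) := (Measure.hausdorffMeasure ((d : ℝ) - 1)).restrict (hull F.1.1) with hμ
  obtain ⟨g, gCR, h1, h2, h3, h4, h5, h6⟩ := T.exists_local_weights A hd hk hFK N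
    (fun F' hF' => hF'.1) (Or.inr ⟨y, z, hzy, congrArg Subtype.val hy, fun h => h.2 rfl⟩)
    μ (fun f hf => T.memLp_facet hd F.1 hf) (fun f hf => T.eq_zero_of_ae_facet hd F.1 hf)
  refine ⟨g, gCR, ?_⟩
  rintro w rfl rfl
  have hFN : F.1 ∈ N := hbN F.1 hFK F.2
  refine ⟨⟨h1, fun F' hF' => h2 F' (hbN F' hF'.1 hF'.2), h3,
    fun i hi F' hF' => h4 i hi F' (hbN F' hF'.1 hF'.2),
    fun F' hF' => h5 F' (hbN F' hF'.1 hF'.2),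
    fun F' hF' F'' hF'' => h6 F' (hbN F' hF'.1 hF'.2) F'' (hbN F'' hF''.1 hF''.2)⟩, ?_⟩
  have key : ∀ g : E d → ℝ, MemLp g 2 μ →
      (∀ F' ∈ N, F' ≠ F.1 → ∫ x, g x * T.crFacet k F' K x ∂μ = 0) →
      ∀ F' : T.Facet, F'.1 ⊆ K.1 → F' ≠ F.1 → ∫ x, g x * T.crFacet k F' K x ∂μ = 0 := by
    intro g hg hN F' hF'K hF'F
    by_cases hF'z : F' = T.facetOpp hd K z
    swap
    · exact hN F' ⟨hF'K, hF'z⟩ hF'F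
    -- On F, λ_y = 0 and P_k(1) = 1, so the functions of the facets opposite t ≠ y add up to zero;
    -- this is solved for t = z.
    have hsum : ∀ x ∈ hull F.1.1, g x * T.crFacet k F' K x =
        -∑ t ∈ (Finset.univ.erase y).erase z, g x * T.crFacet k (T.facetOpp hd K t) K x := by
      intro x hx
      have hx0 : T.bary K y x = 0 := ((T.mem_hull_iff K hFK).1 hx).2 y (by
        rw [hy]
        exact Finset.notMem_erase _ _)
      have h := T.sum_crFacet (k := k) hd K y x
      rw [hx0, mul_zero, sub_zero, jacobi_zero_one, sub_self, ← Finset.add_sum_erase _ _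
        (Finset.mem_erase.2 ⟨hzy, Finset.mem_univ z⟩)] at h
      rw [← Finset.mul_sum, hF'z, eq_neg_of_add_eq_zero_left h]
      ring
    rw [hμ, setIntegral_congr_fun (isCompact_hull _).measurableSet hsum, integral_neg,
      integral_finsetSum, Finset.sum_eq_zero, neg_zero]
    · intro t ht
      have ht' := Finset.mem_erase.1 ht
      refine hN _ ⟨T.facetOpp_subset hd K t, fun h => ht'.1 (T.facetOpp_injective hd K h)⟩ ?_
      rw [hy]
      exact fun h => (Finset.mem_erase.1 ht'.2).1 (T.facetOpp_injective hd K h)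
    · intro t _
      exact hg.integrable_mul (T.memLp_facet hd F.1 (T.continuous_crFacet _ K))
  intro F' hF'K hF'
  have hne : F' ≠ F.1 := fun h => hF' (h ▸ F.2)
  exact ⟨fun i hi => key _ (h1 i hi) (fun F'' hF'' _ => h4 i hi F'' hF'') F' hF'K hne,
    key _ (h2 _ hFN) (fun F'' hF'' hn => by rw [h6 _ hFN F'' hF'', if_neg hn.symm]) F' hF'K hne⟩

theorem exists_weights (hd : 2 ≤ d) (hk : Odd k) (hΩ : IsMeshDomain Ω)
    (hT : 1 < Nat.card T.Cell) :
    ∃ w : T.Weights k, w.Admissible A ∧ ∀ F, w.KillsInner F := by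
  choose g gCR h using fun K => T.exists_cell_weights A hd hk K
  choose g' gCR' h' using fun F => T.exists_facet_weights A hd hk hΩ hT F
  let w : T.Weights k := ⟨g, gCR, g', gCR'⟩
  exact ⟨w, ⟨fun K => h K w rfl rfl, fun F => (h' F w rfl rfl).1⟩, fun F => (h' F w rfl rfl).2⟩

/-! ### The degrees of freedom -/

theorem cellInt_eq_zero {K : T.Cell} {g : E d → ℝ} {u : T.Broken}
    (h : ∀ x ∈ hull K.1, u K x = 0) : T.cellInt K g u = 0 :=
  setIntegral_eq_zero_of_forall_eq_zero fun x hx => by rw [h x hx, mul_zero]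

theorem facetInt_eq_zero {F : T.Facet} {g : E d → ℝ} {u : T.Broken}
    (h : ∀ x ∈ hull F.1, u (T.adj F) x = 0) : T.facetInt F g u = 0 :=
  setIntegral_eq_zero_of_forall_eq_zero fun x hx => by rw [h x hx, mul_zero]

/-- The functional `u ↦ ∫ g u|_K` on a space of functions with continuous pieces is linear. -/
theorem exists_dual_integral (V : Submodule ℝ T.Broken)
    (hV : ∀ u ∈ V, ∀ K : T.Cell, Continuous (u K)) (K : T.Cell) (μ : Measure (E d))
    (hμ : ∀ f : E d → ℝ, Continuous f → MemLp f 2 μ) {g : E d → ℝ} (hg : MemLp g 2 μ) :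
    ∃ L : Module.Dual ℝ V, ∀ u : V, L u = ∫ x, g x * (u : T.Broken) K x ∂μ := by
  have hint : ∀ u : V, Integrable (fun x => g x * (u : T.Broken) K x) μ := fun u =>
    hg.integrable_mul (hμ _ (hV u u.2 K))
  refine ⟨{ toFun := fun u => ∫ x, g x * (u : T.Broken) K x ∂μ
            map_add' := fun u v => ?_
            map_smul' := fun c u => ?_ }, fun u => rfl⟩
  · rw [← integral_add (hint u) (hint v)]
    refine integral_congr_ae (Filter.Eventually.of_forall fun x => ?_)
    simp [mul_add]
  · rw [RingHom.id_apply, smul_eq_mul, ← integral_const_mul]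
    refine integral_congr_ae (Filter.Eventually.of_forall fun x => ?_)
    simp [mul_left_comm]

/-- The face of an index. -/
def indexFace : T.FullIndex k → Finset (E d) := Sum.elim (fun i => i.face.1) (fun F => F.1)

section Dof

variable {T A} (m : T.Marking) {w : T.Weights k}

theorem dof_inl_of_mark_inl {i : T.ConfIndex k} {K : T.Cell}
    (h : m.mark ⟨i.face.1, i.face.2.1⟩ = Sum.inl K) (u : T.Broken) :
    T.dof m w (Sum.inl i) u = T.cellInt K (w.cell K i) u := by
  simp only [dof, h]

theorem dof_inl_of_mark_inr {i : T.ConfIndex k} {F : T.BdryFacet}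
    (h : m.mark ⟨i.face.1, i.face.2.1⟩ = Sum.inr F) (u : T.Broken) :
    T.dof m w (Sum.inl i) u = T.facetInt F.1 (w.facet F i) u := by
  simp only [dof, h]

theorem dof_inr_of_mark_inl {F : T.Facet} {K : T.Cell}
    (h : m.mark ⟨F.1, F.2.1⟩ = Sum.inl K) (u : T.Broken) :
    T.dof m w (Sum.inr F) u = T.cellInt K (w.cellCR K F) u := by
  simp only [dof, h]

/-- The marked facet contains F and has as many vertices, so it is F. -/
theorem dof_inr_of_onBoundary {F : T.Facet} (hF : OnBoundary Ω F.1) (u : T.Broken) :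
    T.dof m w (Sum.inr F) u = T.facetInt F (w.facetCR ⟨F, hF⟩ F) u := by
  obtain ⟨F', h, hsub⟩ := m.bdry ⟨F.1, F.2.1⟩ hF
  have hFF' : F' = ⟨F, hF⟩ := Subtype.ext (Subtype.ext
    (Finset.eq_of_subset_of_card_le hsub (by rw [F.2.2, F'.1.2.2])).symm)
  subst hFF'
  simp only [dof, h]

/-- All basis functions are covered, those of the boundary included: on the marked cell each is
either a member of the local family or zero. -/
theorem dof_inner (hw : ∀ K, w.DualOnCell A K) {i : T.FullIndex k}
    (hi : ¬ OnBoundary Ω (T.indexFace i)) (j : T.FullIndex k) :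
    T.dof m w i (T.crBasis A k j) = if i = j then 1 else 0 := by
  rcases i with i | F
  · obtain ⟨K, hm, hK⟩ := m.inner ⟨i.face.1, i.face.2.1⟩ hi
    rw [dof_inl_of_mark_inl m hm]
    rcases j with j | F'
    · simp only [Sum.inl.injEq]
      by_cases hj : j.face.1 ⊆ K.1
      · exact (hw K).conf_conf i j hK hj
      · rw [if_neg fun h : i = j => hj (h ▸ hK)]
        exact T.cellInt_eq_zero fun x _ => T.confBasis_eq_zero_of_not_subset_cell A j hj x
    · rw [if_neg Sum.inl_ne_inr]
      by_cases hF' : F'.1 ⊆ K.1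
      · exact (hw K).conf_cr i F' hK hF'
      · exact T.cellInt_eq_zero fun x _ => T.crFacet_eq_zero hF' x
  · obtain ⟨K, hm, hK⟩ := m.inner ⟨F.1, F.2.1⟩ hi
    rw [dof_inr_of_mark_inl m hm]
    rcases j with j | F'
    · rw [if_neg Sum.inr_ne_inl]
      by_cases hj : j.face.1 ⊆ K.1
      · exact (hw K).cr_conf F j hK hj
      · exact T.cellInt_eq_zero fun x _ => T.confBasis_eq_zero_of_not_subset_cell A j hj x
    · simp only [Sum.inr.injEq]
      by_cases hF' : F'.1 ⊆ K.1
      · exact (hw K).cr_cr F F' hK hF'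
      · rw [if_neg fun h : F = F' => hF' (h ▸ hK)]
        exact T.cellInt_eq_zero fun x _ => T.crFacet_eq_zero hF' x

/-- Conforming functions of faces not in F vanish on F, and facet functions of other cells vanish on
the adjacent cell. Only inner facets of that cell escape local biduality; hence the alternative in
`hj`. -/
theorem dof_bdry (hw : ∀ F, w.DualOnFacet A F) {i : T.FullIndex k}
    (hi : OnBoundary Ω (T.indexFace i)) (j : T.FullIndex k)
    (hj : OnBoundary Ω (T.indexFace j) ∨ ∀ F, w.KillsInner F) :
    T.dof m w i (T.crBasis A k j) = if i = j then 1 else 0 := by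
  rcases i with i | F
  · obtain ⟨F, hm, hF⟩ := m.bdry ⟨i.face.1, i.face.2.1⟩ hi
    rw [dof_inl_of_mark_inr m hm]
    rcases j with j | F'
    · simp only [Sum.inl.injEq]
      by_cases hjF : j.face.1 ⊆ F.1.1
      · exact (hw F).conf_conf i j hF hjF
      · rw [if_neg fun h : i = j => hjF (h ▸ hF)]
        exact T.facetInt_eq_zero fun x hx =>
          T.confBasis_eq_zero_of_not_subset A j (T.subset_adj F.1) hjF hx
    · rw [if_neg Sum.inl_ne_inr]
      by_cases hF' : F'.1 ⊆ (T.adj F.1).1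
      · by_cases hb : OnBoundary Ω F'.1
        · exact (hw F).conf_cr i hF F' ⟨hF', hb⟩
        · exact ((hj.resolve_left hb) F F' hF' hb).1 i hF
      · exact T.facetInt_eq_zero fun x _ => T.crFacet_eq_zero hF' x
  · have hF : OnBoundary Ω F.1 := hi
    have hFb : F ∈ T.bdryFacetsAt ⟨F, hF⟩ := ⟨T.subset_adj F, hF⟩
    rw [dof_inr_of_onBoundary m hF]
    rcases j with j | F'
    · rw [if_neg Sum.inr_ne_inl]
      by_cases hjF : j.face.1 ⊆ F.1
      · exact (hw ⟨F, hF⟩).cr_conf F hFb j hjF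
      · exact T.facetInt_eq_zero fun x hx =>
          T.confBasis_eq_zero_of_not_subset A j (T.subset_adj F) hjF hx
    · simp only [Sum.inr.injEq]
      by_cases hF' : F'.1 ⊆ (T.adj F).1
      · by_cases hb : OnBoundary Ω F'.1
        · exact (hw ⟨F, hF⟩).cr_cr F hFb F' ⟨hF', hb⟩
        · rw [if_neg fun h : F = F' => hb (h ▸ hF)]
          exact ((hj.resolve_left hb) ⟨F, hF⟩ F' hF' hb).2
      · rw [if_neg fun h : F = F' => hF' (h ▸ T.subset_adj F)]
        exact T.facetInt_eq_zero fun x _ => T.crFacet_eq_zero hF' x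

theorem exists_dual_dof_inner (hw : ∀ K, w.DualOnCell A K) {V : Submodule ℝ T.Broken}
    (hV : ∀ u ∈ V, ∀ K : T.Cell, Continuous (u K)) {i : T.FullIndex k}
    (hi : ¬ OnBoundary Ω (T.indexFace i)) :
    ∃ L : Module.Dual ℝ V, ∀ u : V, L u = T.dof m w i u := by
  rcases i with i | F
  · obtain ⟨K, hm, hK⟩ := m.inner ⟨i.face.1, i.face.2.1⟩ hi
    simp only [dof_inl_of_mark_inl m hm]
    exact T.exists_dual_integral V hV K _ (fun f hf => T.memLp_cell K hf) ((hw K).memLp i hK)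
  · obtain ⟨K, hm, hK⟩ := m.inner ⟨F.1, F.2.1⟩ hi
    simp only [dof_inr_of_mark_inl m hm]
    exact T.exists_dual_integral V hV K _ (fun f hf => T.memLp_cell K hf) ((hw K).memLpCR F hK)

theorem exists_dual_dof_bdry (hd : 2 ≤ d) (hw : ∀ F, w.DualOnFacet A F)
    {V : Submodule ℝ T.Broken} (hV : ∀ u ∈ V, ∀ K : T.Cell, Continuous (u K))
    {i : T.FullIndex k} (hi : OnBoundary Ω (T.indexFace i)) :
    ∃ L : Module.Dual ℝ V, ∀ u : V, L u = T.dof m w i u := by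
  rcases i with i | F
  · obtain ⟨F, hm, hF⟩ := m.bdry ⟨i.face.1, i.face.2.1⟩ hi
    simp only [dof_inl_of_mark_inr m hm]
    exact T.exists_dual_integral V hV _ _ (fun f hf => T.memLp_facet hd F.1 hf)
      ((hw F).memLp i hF)
  · have hF : OnBoundary Ω F.1 := hi
    simp only [dof_inr_of_onBoundary m hF]
    exact T.exists_dual_integral V hV _ _ (fun f hf => T.memLp_facet hd F hf)
      ((hw ⟨F, hF⟩).memLpCR F ⟨T.subset_adj F, hF⟩)

theorem exists_dual_dof (hd : 2 ≤ d) (hk : Odd k) (hw : w.Admissible A) :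
    ∃ L : T.FullIndex k → Module.Dual ℝ (T.CR k), ∀ i (u : T.CR k), L i u = T.dof m w i u := by
  have h : ∀ i : T.FullIndex k, ∃ L : Module.Dual ℝ (T.CR k), ∀ u : T.CR k,
      L u = T.dof m w i u := fun i => by
    by_cases hi : OnBoundary Ω (T.indexFace i)
    · exact exists_dual_dof_bdry m hd hw.onFacet
        (fun u hu K => T.continuous_of_mem_CR hd hk hu K) hi
    · exact exists_dual_dof_inner m hw.onCell (fun u hu K => T.continuous_of_mem_CR hd hk hu K) hi
  choose L hL using h
  exact ⟨L, hL⟩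

theorem isBidual_CR0 (hd : 2 ≤ d) (hk : Odd k) (hΩ : IsMeshDomain Ω)
    (hw : ∀ K, w.DualOnCell A K) : IsBidual (T.CR0 k) (T.crBasis0 A k) (T.dof0 m w) where
  linearIndependent := T.linearIndependent_crBasis0 A hd hk
  span_eq := T.span_crBasis0 A hd hk hΩ
  linear := by
    have h : ∀ i : T.ZeroIndex k, ∃ L : Module.Dual ℝ (T.CR0 k), ∀ u : T.CR0 k,
        L u = T.dof0 m w i u := fun i => by
      refine exists_dual_dof_inner m hw
        (fun u hu K => T.continuous_of_mem_CR hd hk (T.CR0_le_CR hk hu) K) ?_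
      rcases i with i | F
      exacts [i.2, F.2]
    choose L hL using h
    exact ⟨L, hL⟩
  dual i j := by
    have hi : ¬ OnBoundary Ω (T.indexFace i.toFull) := by
      rcases i with i | F
      exacts [i.2, F.2]
    rw [dof0, crBasis0, dof_inner m hw hi]
    simp only [(ZeroIndex.toFull_injective T).eq_iff]
    split_ifs <;> rfl

theorem isBidual_CR (hd : 2 ≤ d) (hk : Odd k) (hw : w.Admissible A)
    (hkill : ∀ F, w.KillsInner F) : IsBidual (T.CR k) (T.crBasis A k) (T.dof m w) where
  linearIndependent := T.linearIndependent_crBasis A hd hk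
  span_eq := T.span_crBasis A hd hk
  linear := exists_dual_dof m hd hk hw
  dual i j := by
    by_cases hi : OnBoundary Ω (T.indexFace i)
    · rw [dof_bdry m hw.onFacet hi j (Or.inr hkill)]
      split_ifs <;> rfl
    · rw [dof_inner m hw.onCell hi j]
      split_ifs <;> rfl

/-- The matrix of the functionals at the basis is block triangular: inner functionals are dual to
everything, boundary ones at least to the boundary functions. -/
theorem isDualSpaceBasis_CR (hd : 2 ≤ d) (hk : Odd k) (hw : w.Admissible A) :
    IsDualSpaceBasis (T.CR k) (T.dof m w) := by
  obtain ⟨L, hL⟩ := exists_dual_dof m hd hk hw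
  have hspan := T.span_crBasis A hd hk
  have hmem : ∀ j, T.crBasis A k j ∈ T.CR k := fun j =>
    hspan ▸ Submodule.subset_span (mem_range_self j)
  have hli : LinearIndependent ℝ L := by
    rw [Fintype.linearIndependent_iff]
    intro a ha
    have hsum : ∀ j, ∑ i, a i * T.dof m w i (T.crBasis A k j) = 0 := fun j => by
      have := LinearMap.congr_fun ha ⟨T.crBasis A k j, hmem j⟩
      rw [LinearMap.sum_apply] at this
      simpa only [LinearMap.smul_apply, hL, smul_eq_mul, LinearMap.zero_apply] using this
    -- The column of j gives a_j = 0 if each boundary functional has zero coefficient or j itself is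
    -- on the boundary; so boundary indices are settled before inner ones.
    have hδ : ∀ j, (∀ i, OnBoundary Ω (T.indexFace i) → a i = 0 ∨
        OnBoundary Ω (T.indexFace j)) → a j = 0 := by
      intro j hj
      rw [← hsum j, Finset.sum_eq_single j]
      · by_cases hb : OnBoundary Ω (T.indexFace j)
        · rw [dof_bdry m hw.onFacet hb j (Or.inl hb), if_pos rfl, mul_one]
        · rw [dof_inner m hw.onCell hb, if_pos rfl, mul_one]
      · intro i _ hij
        by_cases hb : OnBoundary Ω (T.indexFace i)
        · rcases hj i hb with h | h
          · rw [h, zero_mul]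
          · rw [dof_bdry m hw.onFacet hb j (Or.inl h), if_neg hij, mul_zero]
        · rw [dof_inner m hw.onCell hb, if_neg hij, mul_zero]
      · simp
    have hbdry : ∀ j, OnBoundary Ω (T.indexFace j) → a j = 0 := fun j hj =>
      hδ j fun _ _ => Or.inr hj
    exact fun j => hδ j fun i hi => Or.inl (hbdry i hi)
  have hfin : FiniteDimensional ℝ (T.CR k) := by
    rw [← hspan]
    exact FiniteDimensional.span_of_finite ℝ (finite_range _)
  have hcard : Fintype.card (T.FullIndex k) = Module.finrank ℝ (Module.Dual ℝ (T.CR k)) := by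
    rw [Subspace.dual_finrank_eq, ← hspan,
      finrank_span_eq_card (T.linearIndependent_crBasis A hd hk)]
  refine ⟨Module.Basis.mk hli (hli.span_eq_top_of_card_eq_finrank' hcard).ge, fun i u => ?_⟩
  rw [Module.Basis.mk_apply, hL]

end Dof

end Mesh

end CRFem

end

theorem mainTheorem3 {d : ℕ} (hd : 2 ≤ d) {k : ℕ} (hk : Odd k)
    {Ω : Set (CRFem.E d)} (hΩ : CRFem.IsMeshDomain Ω)
    (T : CRFem.Mesh Ω) (hT : 1 < Nat.card T.Cell)
    (A : T.Numbering) (m : T.Marking) :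
    (∃ w : T.Weights k, w.Admissible A ∧ (∀ F, w.KillsInner F) ∧
      CRFem.IsBidual (T.CR k) (T.crBasis A k) (T.dof m w) ∧
      CRFem.IsBidual (T.CR0 k) (T.crBasis0 A k) (T.dof0 m w)) ∧
    (∀ w : T.Weights k, (∀ K, w.DualOnCell A K) →
      CRFem.IsBidual (T.CR0 k) (T.crBasis0 A k) (T.dof0 m w)) ∧
    (∀ w : T.Weights k, w.Admissible A →
      CRFem.IsDualSpaceBasis (T.CR k) (T.dof m w) ∧
      ((∀ F, w.KillsInner F) → CRFem.IsBidual (T.CR k) (T.crBasis A k) (T.dof m w))) := by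
  obtain ⟨w, hw, hkill⟩ := T.exists_weights A hd hk hΩ hT
  exact ⟨⟨w, hw, hkill, CRFem.Mesh.isBidual_CR m hd hk hw hkill,
      CRFem.Mesh.isBidual_CR0 m hd hk hΩ hw.onCell⟩,
    fun w hw => CRFem.Mesh.isBidual_CR0 m hd hk hΩ hw,
    fun w hw => ⟨CRFem.Mesh.isDualSpaceBasis_CR m hd hk hw,
      fun hkill => CRFem.Mesh.isBidual_CR m hd hk hw hkill⟩⟩
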